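/- Let $p\in\{1,2,3\}$, $\varepsilon\in\{1,-1\}$ and let $\alpha,c\in\mathbb R$ satisfy $\alpha\varepsilon<0$ and $c\alpha<0$. Let $\mathscr H$ denote the Hilbert transform in $x$, $$\mathscr H u(x,y)=\mathrm{p.v.}\,\frac1\pi\int_{\mathbb R}\frac{u(z,y)}{x-z}\,dz ,$$ and let $\mathscr Z\subset L^2(\mathbb R^2)$ be the closure of the real-valued functions in $C_0^\infty(\mathbb R^2)$ for the norm $$\|\varphi\|_{\mathscr Z}=\Bigl(\|\varphi\|_{L^2}^2+\|\varphi_y\|_{L^2}^2+\bigl\|D_x^{1/2}\varphi\bigr\|_{L^2}^2\Bigr)^{1/2},\qquad \widehat{D_x^{1/2}\varphi}(\xi_1,\xi_2)=|\xi_1|^{1/2}\,\widehat\varphi(\xi_1,\xi_2).$$ Let $\varphi\in\mathscr Z$ be a (real-valued) solitary wave, that is, a solution, in the sense of distributions on $\mathbb R^2$, of $$-c\varphi+\frac1{p+1}\varphi^{p+1}+\alpha\,\mathscr H\varphi_x+\varepsilon\,\varphi_{yy}=0 .$$ Then there are $\sigma>0$ and a function $f$, holomorphic in the two complex variables $z_1,z_2$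 in the domain $$\bigl\{(z_1,z_2)\in\mathbb C^2:\ |\mathrm{Im}\,z_1|<\sigma,\ |\mathrm{Im}\,z_2|<\sigma\bigr\},$$ such that $f(x,y)=\varphi(x,y)$ for almost every $(x,y)\in\mathbb R^2$, and for all $(x,y)\in\mathbb R^2$ if $\varphi$ is the continuous representative of its class. -/

import Mathlib

namespace BOZK

noncomputable section

/-- Test functions: the real-valued functions of class `C_0^∞` on `ℝ²` (coordinates `(x, y)`). -/
def IsTest (ψ : ℝ × ℝ → ℝ) : Prop :=
  ContDiff ℝ (⊤ : ℕ∞) ψ ∧ HasCompactSupport ψ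

/-- The partial derivative `∂ψ/∂x`. -/
def partialX (ψ : ℝ × ℝ → ℝ) (z : ℝ × ℝ) : ℝ :=
  deriv (fun x : ℝ => ψ (x, z.2)) z.1

/-- The partial derivative `∂ψ/∂y`. -/
def partialY (ψ : ℝ × ℝ → ℝ) (z : ℝ × ℝ) : ℝ :=
  deriv (fun y : ℝ => ψ (z.1, y)) z.2

/-- The Fourier transform `ψ̂(ξ₁, ξ₂) = ∫ e^{-i(x ξ₁ + y ξ₂)} ψ(x, y) dx dy`. -/
def fourierR2 (ψ : ℝ × ℝ → ℝ) (ξ : ℝ × ℝ) : ℂ :=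
  ∫ z : ℝ × ℝ, Complex.exp (-(Complex.I * ((z.1 * ξ.1 + z.2 * ξ.2 : ℝ) : ℂ))) * ((ψ z : ℝ) : ℂ)

/-- The `𝒵`-norm `(‖ψ‖² + ‖ψ_y‖² + ‖D_x^{1/2} ψ‖²)^{1/2}` (norms of `L²(ℝ²)`) of a test function.
Here `D_x^{1/2} ψ` has the Fourier transform `|ξ₁|^{1/2} ψ̂`, so that, by Plancherel's identity in
the above normalization, `‖D_x^{1/2} ψ‖² = (2π)⁻² ∫ |ξ₁| |ψ̂(ξ)|² dξ`. -/
def zNorm (ψ : ℝ × ℝ → ℝ) : ℝ :=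
  Real.sqrt ((∫ z : ℝ × ℝ, ψ z ^ 2) + (∫ z : ℝ × ℝ, partialY ψ z ^ 2)
    + ((2 * Real.pi) ^ 2)⁻¹ * ∫ ξ : ℝ × ℝ, |ξ.1| * ‖fourierR2 ψ ξ‖ ^ 2)

/-- The space `𝒵`: the closure (completion) of `C_0^∞(ℝ²)` for the `𝒵`-norm, realized inside
`L²(ℝ²)`: the functions of `L²` that are the `L²`-limit of a `𝒵`-Cauchy sequence of test
functions. -/
def MemZ (φ : ℝ × ℝ → ℝ) : Prop :=
  MeasureTheory.MemLp φ 2 MeasureTheory.volume ∧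
    ∃ ψ : ℕ → ℝ × ℝ → ℝ,
      (∀ n, IsTest (ψ n)) ∧
      (∀ δ : ℝ, 0 < δ → ∃ N : ℕ, ∀ m n : ℕ, N ≤ m → N ≤ n → zNorm (ψ m - ψ n) < δ) ∧
      Filter.Tendsto (fun n => MeasureTheory.eLpNorm (ψ n - φ) 2 MeasureTheory.volume)
        Filter.atTop (nhds 0)

/-- The Hilbert transform in the variable `x`:
`(ℋ u)(x, y) = p.v. (1/π) ∫ u(z, y) / (x - z) dz`. It is applied below only to the
`x`-derivatives of test functions, for which the principal value exists at every point. -/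
def hilbertX (u : ℝ × ℝ → ℝ) (w : ℝ × ℝ) : ℝ :=
  Filter.limUnder (nhdsWithin (0 : ℝ) (Set.Ioi 0)) fun δ : ℝ =>
    (1 / Real.pi) * ∫ z in {z : ℝ | δ < |w.1 - z|}, u (z, w.2) / (w.1 - z)

/-- `φ ∈ 𝒵` is a solitary wave with speed `c` for the parameters `p`, `α`, `ε`, that is, a
solution in the sense of distributions of
`-c φ + φ^{p+1} / (p+1) + α ℋ φ_x + ε φ_yy = 0`. Since `ℋ ∂_x` and `∂_y²` are formally
self-adjoint, they are moved to the test function. For `φ ∈ 𝒵` and `p ≤ 4` all the terms are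
integrable, because `𝒵` embeds in `L²` and `L⁶`. -/
structure IsSolitaryWave (p : ℕ) (α ε c : ℝ) (φ : ℝ × ℝ → ℝ) : Prop where
  memZ : MemZ φ
  weak_eq : ∀ ψ : ℝ × ℝ → ℝ, IsTest ψ →
    ∫ z : ℝ × ℝ,
      (φ z * (-c * ψ z + α * hilbertX (partialX ψ) z + ε * partialY (partialY ψ) z)
        + φ z ^ (p + 1) / ((p : ℝ) + 1) * ψ z) = 0

/-- The domain `{(z₁, z₂) ∈ ℂ² : |Im z₁| < σ, |Im z₂| < σ}`. -/
def strip (σ : ℝ) : Set (ℂ × ℂ) :=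
  {z | |z.1.im| < σ ∧ |z.2.im| < σ}

end

end BOZK

/-! Let `U` be the Fourier transform of `φ`, taken with `𝓕⁻` so that `φ = 𝓕 U`. The equation becomes
`symbol · U = -(p + 1)⁻¹ 𝓕⁻(φ ^ (p + 1))`. The sign conditions give the three terms of the symbol
the same sign, so its modulus is at least a multiple of the weight `1 + |ξ₁| + ξ₂²`
(`weight_le_abs_symbol`). The transform of the power is dominated by the convolution of `p + 1`
copies of `|U|`. Hence `V = |U|` satisfies `weight · V ≤ K · V ∗ ⋯ ∗ V`, and membership in `𝒵` gives
`∫ weight · V² < ∞` (`IsSolitaryWave.exists_convolution_ineq`). Analyticity follows from these two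
facts by real-variable estimates on nonnegative functions.

Integrability of `V` is a bootstrap (`lintegral_lt_top_of_weighted`). The inverse weight lies in
`L^r` for `r > 3/2`, so Young's and Hölder's inequalities turn the reciprocal Lebesgue exponent `a`
of `V` into `(p + 1) a - p + q` for any `q < 2/3`. This is a gain when `p (1 - a) < q`; since any
`a` between `1/2` and `5/6` is available at the start, a gain is possible exactly for `p < 4`.

Exponential decay is a continuity argument (`exists_exp_lintegral_lt_top`). With `t` the weight's
truncated `ℓ¹` norm times `s`, the bound `e^t ≤ 1 + t e^t` and subadditivity of the norm give `Y(s)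
≤ Y(0) + s K Y(s)^(p + 1)` for the exponential moment `Y`. For small `s` a continuous `Y` cannot
cross a fixed level, uniformly in the truncation. Once `e^(s(|ξ₁| + |ξ₂|)) U` is integrable, the
Fourier integral of `U` extends holomorphically to a strip (`differentiableOn_fourierLaplace`). -/

open MeasureTheory Filter Topology
open scoped ENNReal NNReal FourierTransform SchwartzMap Convolution LineDeriv

set_option linter.unusedSectionVars false

namespace BOZK

noncomputable section

/-! ### Hölder, Young and convolution powers in terms of reciprocal exponents. -/

section Inequalities

variable {G : Type*} [MeasurableSpace G]

/-- The Lebesgue norm of exponent `1 / a` of a nonnegative function. -/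
def recipNorm (a : ℝ) (f : G → ℝ≥0∞) (μ : Measure G) : ℝ≥0∞ :=
  (∫⁻ x, f x ^ (1 / a) ∂μ) ^ a

theorem recipNorm_one (f : G → ℝ≥0∞) (μ : Measure G) : recipNorm 1 f μ = ∫⁻ x, f x ∂μ := by
  simp [recipNorm]

theorem recipNorm_mono {a : ℝ} (ha : 0 < a) {f g : G → ℝ≥0∞} {μ : Measure G}
    (h : ∀ᵐ x ∂μ, f x ≤ g x) : recipNorm a f μ ≤ recipNorm a g μ := by
  unfold recipNorm
  refine ENNReal.rpow_le_rpow (lintegral_mono_ae ?_) ha.le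
  filter_upwards [h] with x hx
  exact ENNReal.rpow_le_rpow hx (by positivity)

theorem recipNorm_const_mul {a : ℝ} (ha : 0 < a) {K : ℝ≥0∞} (hK : K ≠ ⊤) (f : G → ℝ≥0∞)
    (μ : Measure G) : recipNorm a (fun x => K * f x) μ = K * recipNorm a f μ := by
  unfold recipNorm
  have h1 : 0 ≤ 1 / a := by positivity
  simp_rw [ENNReal.mul_rpow_of_nonneg _ _ h1]
  rw [lintegral_const_mul' _ _ (ENNReal.rpow_ne_top_of_nonneg h1 hK),
    ENNReal.mul_rpow_of_nonneg _ _ ha.le, ← ENNReal.rpow_mul, one_div_mul_cancel ha.ne',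
    ENNReal.rpow_one]

/-- Hölder's inequality. -/
theorem recipNorm_mul_le {μ : Measure G} {a b : ℝ} (ha : 0 < a) (hb : 0 < b) {f g : G → ℝ≥0∞}
    (hf : AEMeasurable f μ) (hg : AEMeasurable g μ) :
    recipNorm (a + b) (fun x => f x * g x) μ ≤ recipNorm a f μ * recipNorm b g μ := by
  unfold recipNorm
  have hab : 0 < a + b := by positivity
  have key := ENNReal.lintegral_mul_norm_pow_le (μ := μ) (hf.pow_const (1 / a))
    (hg.pow_const (1 / b)) (p := a / (a + b)) (q := b / (a + b)) (by positivity) (by positivity)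
    (by field_simp)
  have e : ∀ x, (f x ^ (1 / a)) ^ (a / (a + b)) * (g x ^ (1 / b)) ^ (b / (a + b))
      = (f x * g x) ^ (1 / (a + b)) := by
    intro x
    rw [← ENNReal.rpow_mul, ← ENNReal.rpow_mul, ENNReal.mul_rpow_of_nonneg _ _ (by positivity)]
    congr 2 <;> field_simp
  simp_rw [e] at key
  refine (ENNReal.rpow_le_rpow key hab.le).trans_eq ?_
  rw [ENNReal.mul_rpow_of_nonneg _ _ hab.le, ← ENNReal.rpow_mul, ← ENNReal.rpow_mul,
    div_mul_cancel₀ _ hab.ne', div_mul_cancel₀ _ hab.ne']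

variable [AddCommGroup G] [MeasurableAdd₂ G] [MeasurableNeg G] {μ : Measure G}
  [μ.IsAddLeftInvariant] [μ.IsNegInvariant] [SFinite μ]

theorem lintegral_lconvolution {f g : G → ℝ≥0∞} (hf : Measurable f) (hg : Measurable g) :
    ∫⁻ x, lconvolution f g μ x ∂μ = (∫⁻ x, f x ∂μ) * ∫⁻ x, g x ∂μ := by
  simp_rw [lconvolution_def]
  rw [lintegral_lintegral_swap (by fun_prop)]
  have : ∀ y, ∫⁻ x, f y * g (-y + x) ∂μ = f y * ∫⁻ x, g x ∂μ := by
    intro y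
    rw [lintegral_const_mul _ (by fun_prop), lintegral_add_left_eq_self]
  simp_rw [this]
  rw [lintegral_mul_const _ hf]

/-- Young's inequality for convolutions. -/
theorem recipNorm_lconvolution_le {a b : ℝ} (ha : a ≤ 1) (hb : b ≤ 1)
    (hab : 1 < a + b) {f g : G → ℝ≥0∞} (hf : Measurable f) (hg : Measurable g) :
    recipNorm (a + b - 1) (lconvolution f g μ) μ ≤ recipNorm a f μ * recipNorm b g μ := by
  set c := a + b - 1 with hc
  have hc0 : 0 < c := by linarith
  have ha0 : 0 < a := by linarith
  have hb0 : 0 < b := by linarith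
  have hca : 0 ≤ a - c := by linarith
  have hcb : 0 ≤ b - c := by linarith
  set F : G → ℝ≥0∞ := fun x => f x ^ (1 / a)
  set H : G → ℝ≥0∞ := fun x => g x ^ (1 / b)
  have hF : Measurable F := hf.pow_const _
  have hH : Measurable H := hg.pow_const _
  -- The integrand `f g` is `(F H)^c F^(a - c) H^(b - c)`. These exponents are nonnegative, as `a -
  -- c = 1 - b` and `b - c = 1 - a`, and they add up to `1`, so Hölder for three factors applies.
  have pt : ∀ x, lconvolution f g μ x ≤ (lconvolution F H μ x) ^ c *
      ((∫⁻ y, F y ∂μ) ^ (a - c) * (∫⁻ y, H y ∂μ) ^ (b - c)) := by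
    intro x
    have key := ENNReal.lintegral_prod_norm_pow_le (μ := μ) (Finset.univ : Finset (Fin 3))
      (f := ![fun y => F y * H (-y + x), F, fun y => H (-y + x)])
      (by intro i _; fin_cases i <;> simp <;> fun_prop)
      (p := ![c, a - c, b - c]) (by simp [Fin.sum_univ_three, hc]; ring)
      (by intro i _; fin_cases i <;> simp [hc0.le] <;> linarith)
    simp only [Fin.prod_univ_three, Matrix.cons_val_zero, Matrix.cons_val_one,
      Matrix.cons_val] at key
    have e : ∀ y, (F y * H (-y + x)) ^ c * F y ^ (a - c) * H (-y + x) ^ (b - c)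
        = f y * g (-y + x) := by
      intro y
      rw [ENNReal.mul_rpow_of_nonneg _ _ hc0.le, mul_assoc, mul_mul_mul_comm,
        mul_comm (H (-y + x) ^ c), ← mul_assoc, ← ENNReal.rpow_add_of_nonneg _ _ hc0.le hca,
        mul_assoc, mul_comm (H (-y + x) ^ (b - c)), ← ENNReal.rpow_add_of_nonneg _ _ hc0.le hcb]
      simp only [F, H]
      rw [← ENNReal.rpow_mul, ← ENNReal.rpow_mul]
      simp [ha0.ne', hb0.ne']
    simp_rw [e] at key
    have e2 : ∫⁻ y, H (-y + x) ∂μ = ∫⁻ y, H y ∂μ := by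
      simp_rw [neg_add_eq_sub]
      exact lintegral_sub_left_eq_self H x
    rw [e2, mul_assoc] at key
    exact key
  unfold recipNorm
  have h1c : 0 ≤ 1 / c := by positivity
  calc (∫⁻ x, lconvolution f g μ x ^ (1 / c) ∂μ) ^ c
      ≤ (∫⁻ x, lconvolution F H μ x *
        ((∫⁻ y, F y ∂μ) ^ (a - c) * (∫⁻ y, H y ∂μ) ^ (b - c)) ^ (1 / c) ∂μ) ^ c := by
        gcongr with x
        refine (ENNReal.rpow_le_rpow (pt x) h1c).trans_eq ?_
        rw [ENNReal.mul_rpow_of_nonneg _ _ h1c, ← ENNReal.rpow_mul]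
        simp [hc0.ne']
    _ = ((∫⁻ y, F y ∂μ) * ∫⁻ y, H y ∂μ) ^ c *
        ((∫⁻ y, F y ∂μ) ^ (a - c) * (∫⁻ y, H y ∂μ) ^ (b - c)) := by
        rw [lintegral_mul_const _ (measurable_lconvolution μ hF hH), lintegral_lconvolution hF hH,
          ENNReal.mul_rpow_of_nonneg _ _ hc0.le, ← ENNReal.rpow_mul, one_div_mul_cancel hc0.ne',
          ENNReal.rpow_one]
    _ = (∫⁻ y, F y ∂μ) ^ a * (∫⁻ y, H y ∂μ) ^ b := by
        rw [ENNReal.mul_rpow_of_nonneg _ _ hc0.le, mul_mul_mul_comm,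
          ← ENNReal.rpow_add_of_nonneg _ _ hc0.le hca, ← ENNReal.rpow_add_of_nonneg _ _ hc0.le hcb]
        simp

/-- The convolution of `n + 1` copies of `f`. -/
def convPow (f : G → ℝ≥0∞) (μ : Measure G) : ℕ → G → ℝ≥0∞
  | 0 => f
  | n + 1 => lconvolution f (convPow f μ n) μ

@[fun_prop]
theorem measurable_convPow {f : G → ℝ≥0∞} (hf : Measurable f) (n : ℕ) :
    Measurable (convPow f μ n) := by
  induction n with
  | zero => exact hf
  | succ n ih => exact measurable_lconvolution μ hf ih

theorem lintegral_convPow {f : G → ℝ≥0∞} (hf : Measurable f) (n : ℕ) :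
    ∫⁻ x, convPow f μ n x ∂μ = (∫⁻ x, f x ∂μ) ^ (n + 1) := by
  induction n with
  | zero => simp [convPow]
  | succ n ih =>
    rw [convPow, lintegral_lconvolution hf (measurable_convPow hf n), ih, ← pow_succ']

/-- Iterated Young: each convolution with `f` lowers the reciprocal exponent by `1 - a`. The
exponents decrease along the iteration, so positivity of the last one suffices. -/
theorem recipNorm_convPow_le {a : ℝ} (ha : a ≤ 1) {f : G → ℝ≥0∞} (hf : Measurable f) (n : ℕ)
    (h : 0 < (n + 1) * a - n) :
    recipNorm ((n + 1) * a - n) (convPow f μ n) μ ≤ recipNorm a f μ ^ (n + 1) := by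
  induction n with
  | zero => simp [convPow]
  | succ n ih =>
    push_cast at h ⊢
    have hn : (0 : ℝ) ≤ n := n.cast_nonneg
    have h1 : ((n : ℝ) + 1) * a - n ≤ 1 := by nlinarith
    have h0 : 0 < ((n : ℝ) + 1) * a - n := by nlinarith
    have hy := recipNorm_lconvolution_le (μ := μ) ha h1 (by linarith) hf
      (measurable_convPow (μ := μ) hf n)
    have e : ((n : ℝ) + 1 + 1) * a - (n + 1) = a + ((n + 1) * a - n) - 1 := by ring
    rw [e, pow_succ']
    exact hy.trans (by gcongr; exact ih h0)

theorem convPow_mono {f g : G → ℝ≥0∞} (h : ∀ x, f x ≤ g x) (n : ℕ) (x : G) :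
    convPow f μ n x ≤ convPow g μ n x := by
  induction n generalizing x with
  | zero => exact h x
  | succ n ih =>
    simp only [convPow, lconvolution_def]
    gcongr
    · exact h _
    · exact ih _

/-- Submultiplicative weights pass through convolution powers. -/
theorem mul_convPow_le {e f : G → ℝ≥0∞} (hf : Measurable f)
    (h : ∀ x y, e (x + y) ≤ e x * e y) (n : ℕ) (x : G) :
    e x * convPow f μ n x ≤ convPow (fun y => e y * f y) μ n x := by
  induction n generalizing x with
  | zero => exact le_rfl
  | succ n ih =>
    simp only [convPow, lconvolution_def]
    have := measurable_convPow (μ := μ) hf n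
    rw [← lintegral_const_mul _ (by fun_prop)]
    refine lintegral_mono fun y => ?_
    calc e x * (f y * convPow f μ n (-y + x))
        ≤ (e y * e (-y + x)) * (f y * convPow f μ n (-y + x)) := by
          gcongr
          simpa using h y (-y + x)
      _ = (e y * f y) * (e (-y + x) * convPow f μ n (-y + x)) := by ring
      _ ≤ _ := by gcongr; exact ih _

end Inequalities

/-! ### The anisotropic weight and its integrability. -/

/-- The Euclidean plane. -/
abbrev Plane : Type := WithLp 2 (ℝ × ℝ)

theorem measurePreserving_ofLp :
    MeasurePreserving (WithLp.ofLp : Plane → ℝ × ℝ) volume volume :=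
  WithLp.volume_preserving_ofLp ℝ ℝ

theorem measurableEmbedding_ofLp : MeasurableEmbedding (WithLp.ofLp : Plane → ℝ × ℝ) :=
  (MeasurableEquiv.toLp 2 (ℝ × ℝ)).symm.measurableEmbedding

@[fun_prop]
theorem continuous_plane_fst : Continuous (fun ξ : Plane => ξ.fst) :=
  continuous_fst.comp (WithLp.prod_continuous_ofLp 2 ℝ ℝ)

@[fun_prop]
theorem continuous_plane_snd : Continuous (fun ξ : Plane => ξ.snd) :=
  continuous_snd.comp (WithLp.prod_continuous_ofLp 2 ℝ ℝ)

@[fun_prop]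
theorem measurable_plane_fst : Measurable (fun ξ : Plane => ξ.fst) :=
  continuous_plane_fst.measurable

/-- The anisotropic elliptic weight `1 + |ξ₁| + ξ₂²`. -/
def weight (ξ : Plane) : ℝ := 1 + |ξ.fst| + ξ.snd ^ 2

@[fun_prop]
theorem continuous_weight : Continuous weight := by unfold weight; fun_prop

@[fun_prop]
theorem measurable_weight : Measurable weight := continuous_weight.measurable

theorem one_le_weight (ξ : Plane) : 1 ≤ weight ξ := by
  unfold weight; nlinarith [abs_nonneg ξ.fst, sq_nonneg ξ.snd]

theorem weight_pos (ξ : Plane) : 0 < weight ξ := by linarith [one_le_weight ξ]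

/-- The elliptic weight with values in the extended nonnegative reals. -/
def eweight (ξ : Plane) : ℝ≥0∞ := ENNReal.ofReal (weight ξ)

@[fun_prop]
theorem measurable_eweight : Measurable eweight := by unfold eweight; fun_prop

theorem eweight_ne_top (ξ : Plane) : eweight ξ ≠ ⊤ := ENNReal.ofReal_ne_top

theorem eweight_ne_zero (ξ : Plane) : eweight ξ ≠ 0 := by simp [eweight, weight_pos]

theorem one_le_eweight (ξ : Plane) : 1 ≤ eweight ξ := by
  simpa [eweight] using one_le_weight ξ

/-- The threshold is `3/2 = 1 + 1/2`: slightly more than one power of the weight makes the `ξ₁`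
integral converge, slightly more than half a power the `ξ₂` integral. The excess over `3/2` is
shared equally between the two. -/
theorem integrable_weight_rpow {s : ℝ} (hs : 3 / 2 < s) :
    Integrable (fun ξ => weight ξ ^ (-s)) := by
  obtain ⟨δ, hδ⟩ : ∃ δ, δ = (s - 3 / 2) / 2 := ⟨_, rfl⟩
  have hδ0 : 0 < δ := by linarith
  have h1 : Integrable (fun x : ℝ => (1 + ‖x‖) ^ (-(1 + δ))) :=
    integrable_one_add_norm (by simp; linarith)
  have h2 : Integrable (fun x : ℝ => (1 + ‖x‖ ^ 2) ^ (-(1 + 2 * δ) / 2)) :=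
    integrable_rpow_neg_one_add_norm_sq (by simp; linarith)
  have h3 := h1.mul_prod h2
  have h4 := (measurePreserving_ofLp.integrable_comp_emb measurableEmbedding_ofLp).2 h3
  refine h4.mono' (measurable_weight.pow_const _).aestronglyMeasurable (Eventually.of_forall fun ξ => ?_)
  have hw := weight_pos ξ
  rw [Real.norm_of_nonneg (by positivity)]
  have e : -s = -(1 + δ) + -(1 + 2 * δ) / 2 := by rw [hδ]; ring
  rw [e, Real.rpow_add hw]
  simp only [Function.comp, Real.norm_eq_abs]
  have a1 : 1 + |ξ.fst| ≤ weight ξ := by unfold weight; nlinarith [sq_nonneg ξ.snd]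
  have a2 : 1 + |ξ.snd| ^ 2 ≤ weight ξ := by
    unfold weight; rw [sq_abs]; nlinarith [abs_nonneg ξ.fst]
  exact mul_le_mul (Real.rpow_le_rpow_of_nonpos (by positivity) a1 (by linarith))
    (Real.rpow_le_rpow_of_nonpos (by positivity) a2 (by linarith)) (by positivity) (by positivity)

theorem lintegral_eweight_rpow_lt_top {s : ℝ} (hs : 3 / 2 < s) :
    ∫⁻ ξ, eweight ξ ^ (-s) < ⊤ := by
  have := (integrable_weight_rpow hs).lintegral_lt_top
  simpa [eweight, ENNReal.ofReal_rpow_of_pos (weight_pos _)] using this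

theorem recipNorm_eweight_lt_top {a q : ℝ} (hq : 0 < q) (h : 3 / 2 * q < a) :
    recipNorm q (fun ξ => eweight ξ ^ (-a)) volume < ⊤ := by
  unfold recipNorm
  refine ENNReal.rpow_lt_top_of_nonneg hq.le ?_
  simp_rw [← ENNReal.rpow_mul]
  have e : -a * (1 / q) = -(a / q) := by ring
  rw [e]
  exact (lintegral_eweight_rpow_lt_top (by rwa [lt_div_iff₀ hq])).ne

/-- The weighted `L²` space embeds into `L^{1/a}` for `1/2 < a < 5/6`. -/
theorem recipNorm_le_weighted {V : Plane → ℝ≥0∞} (hV : Measurable V) {a : ℝ} (ha : 1 / 2 < a) :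
    recipNorm a V volume ≤ recipNorm (a - 1 / 2) (fun ξ => eweight ξ ^ (-(1 / 2) : ℝ)) volume *
      (∫⁻ ξ, eweight ξ * V ξ ^ 2) ^ (1 / 2 : ℝ) := by
  -- Hölder for the factorization of `V` into `weight^(-1/2)` and `weight^(1/2) V`, the second
  -- factor being in `L²`.
  have h := recipNorm_mul_le (μ := volume) (a := a - 1 / 2) (b := 1 / 2) (by linarith) (by norm_num)
    (f := fun ξ => eweight ξ ^ (-(1 / 2) : ℝ)) (g := fun ξ => eweight ξ ^ (1 / 2 : ℝ) * V ξ)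
    (by fun_prop) (by fun_prop)
  have e : ∀ ξ, eweight ξ ^ (-(1 / 2) : ℝ) * (eweight ξ ^ (1 / 2 : ℝ) * V ξ) = V ξ := by
    intro ξ
    rw [← mul_assoc, ← ENNReal.rpow_add _ _ (eweight_ne_zero ξ) (eweight_ne_top ξ)]
    simp
  simp_rw [e] at h
  rw [sub_add_cancel] at h
  refine h.trans_eq ?_
  congr 1
  unfold recipNorm
  congr 2
  ext ξ
  rw [ENNReal.mul_rpow_of_nonneg _ _ (by norm_num), ← ENNReal.rpow_mul]
  norm_num

/-- The bound `a < 5/6` is the condition `3/2 · (a - 1/2) < 1/2` under which `weight^(-1/2)` has a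
finite norm of exponent `1 / (a - 1/2)`. -/
theorem recipNorm_lt_top_of_weighted {V : Plane → ℝ≥0∞} (hV : Measurable V)
    (h : ∫⁻ ξ, eweight ξ * V ξ ^ 2 < ⊤) {a : ℝ} (ha : 1 / 2 < a) (ha' : a < 5 / 6) :
    recipNorm a V volume < ⊤ :=
  (recipNorm_le_weighted hV ha).trans_lt (ENNReal.mul_lt_top
    (recipNorm_eweight_lt_top (by linarith) (by linarith))
    (ENNReal.rpow_lt_top_of_nonneg (by norm_num) h.ne))

/-! ### From the convolution inequality to integrability and exponential decay. -/

section Bootstrap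

variable {V : Plane → ℝ≥0∞} {K : ℝ≥0∞} {p : ℕ}

/-- Dividing the inequality by the weight, Young controls the convolution power and Hölder adds the
exponent `q` of the inverse weight, which is admissible because `3/2 · q < 1`. -/
theorem recipNorm_bootstrap (hV : Measurable V) (hK : K ≠ ⊤)
    (hineq : ∀ᵐ ξ, eweight ξ * V ξ ≤ K * convPow V volume p ξ) {a q : ℝ} (ha : a ≤ 1) (hpos : 0 < (p + 1) * a - p) (hq : 0 < q)
    (hq' : q < 2 / 3) (hfin : recipNorm a V volume < ⊤) :
    recipNorm (q + ((p + 1) * a - p)) V volume < ⊤ := by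
  have hle : ∀ᵐ ξ, V ξ ≤ K * (eweight ξ ^ (-1 : ℝ) * convPow V volume p ξ) := by
    filter_upwards [hineq] with ξ hξ
    rw [mul_left_comm, ENNReal.rpow_neg_one]
    calc V ξ = (eweight ξ)⁻¹ * (eweight ξ * V ξ) := by
          rw [← mul_assoc, ENNReal.inv_mul_cancel (eweight_ne_zero ξ) (eweight_ne_top ξ), one_mul]
      _ ≤ _ := by gcongr
  refine (recipNorm_mono (by linarith) hle).trans_lt ?_
  rw [recipNorm_const_mul (by linarith) hK]
  refine ENNReal.mul_lt_top hK.lt_top ((recipNorm_mul_le hq hpos (by fun_prop)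
    (measurable_convPow hV p).aemeasurable).trans_lt (ENNReal.mul_lt_top
      (recipNorm_eweight_lt_top hq (by linarith)) ?_))
  exact (recipNorm_convPow_le ha hV p hpos).trans_lt (ENNReal.pow_lt_top hfin)

theorem lintegral_lt_top_of_weighted (hV : Measurable V) (hK : K ≠ ⊤)
    (hineq : ∀ᵐ ξ, eweight ξ * V ξ ≤ K * convPow V volume p ξ) (hp : 1 ≤ p) (hp' : p < 4)
    (h2 : ∫⁻ ξ, eweight ξ * V ξ ^ 2 < ⊤) : ∫⁻ ξ, V ξ < ⊤ := by
  rw [← recipNorm_one]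
  have h0 : recipNorm (4 / 5) V volume < ⊤ :=
    recipNorm_lt_top_of_weighted hV h2 (by norm_num) (by norm_num)
  -- Starting from `a = 4/5`, the map `a ↦ q + (p + 1) a - p` reaches `1` as follows: `2/5 + 3/5`
  -- for `p = 1`, `3/5 + 2/5` for `p = 2`, and two rounds for `p = 3`, namely `13/20 + 1/5 = 17/20`,
  -- then `3/5 + 2/5`.
  interval_cases p
  · have := recipNorm_bootstrap hV hK hineq (q := 2 / 5) (by norm_num) (by norm_num) (by norm_num)
      (by norm_num) h0
    norm_num at this
    exact this
  · have := recipNorm_bootstrap hV hK hineq (q := 3 / 5) (by norm_num) (by norm_num) (by norm_num)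
      (by norm_num) h0
    norm_num at this
    exact this
  · have h1 := recipNorm_bootstrap hV hK hineq (q := 13 / 20) (by norm_num) (by norm_num)
      (by norm_num) (by norm_num) h0
    norm_num at h1
    have := recipNorm_bootstrap hV hK hineq (q := 3 / 5) (by norm_num) (by norm_num) (by norm_num)
      (by norm_num) h1
    norm_num at this
    exact this

/-- The truncated `ℓ¹` norm on the plane. -/
def truncNorm (R : ℝ) (ξ : Plane) : ℝ := min (|ξ.fst| + |ξ.snd|) R

@[fun_prop]
theorem continuous_truncNorm (R : ℝ) : Continuous (truncNorm R) := by unfold truncNorm; fun_prop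

@[fun_prop]
theorem measurable_truncNorm (R : ℝ) : Measurable (truncNorm R) :=
  (continuous_truncNorm R).measurable

theorem truncNorm_nonneg {R : ℝ} (hR : 0 ≤ R) (ξ : Plane) : 0 ≤ truncNorm R ξ :=
  le_min (by positivity) hR

theorem truncNorm_le_weight (R : ℝ) (ξ : Plane) : truncNorm R ξ ≤ weight ξ := by
  refine (min_le_left _ _).trans ?_
  unfold weight
  rw [← sq_abs ξ.snd]
  nlinarith [sq_nonneg (|ξ.snd| - 1)]

theorem truncNorm_add_le {R : ℝ} (hR : 0 ≤ R) (ξ η : Plane) :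
    truncNorm R (ξ + η) ≤ truncNorm R ξ + truncNorm R η := by
  have h1 : |(ξ + η).fst| ≤ |ξ.fst| + |η.fst| := abs_add_le _ _
  have h2 : |(ξ + η).snd| ≤ |ξ.snd| + |η.snd| := abs_add_le _ _
  have := abs_nonneg ξ.fst
  have := abs_nonneg η.fst
  have := abs_nonneg ξ.snd
  have := abs_nonneg η.snd
  unfold truncNorm
  rcases min_cases (|ξ.fst| + |ξ.snd|) R with h | h <;>
  rcases min_cases (|η.fst| + |η.snd|) R with h' | h' <;>
  rcases min_cases (|(ξ + η).fst| + |(ξ + η).snd|) R with h'' | h'' <;> linarith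

/-- The exponential weight is submultiplicative, so it passes inside the convolution power, whose
integral is the power of the integral. The elliptic weight pays for the factor lost in bounding the
exponential, which produces the small coefficient `s`. -/
theorem exp_weighted_lintegral_le (hV : Measurable V)
    (hineq : ∀ᵐ ξ, eweight ξ * V ξ ≤ K * convPow V volume p ξ) {R s : ℝ} (hR : 0 ≤ R)
    (hs : 0 ≤ s) :
    ∫⁻ ξ, ENNReal.ofReal (Real.exp (s * truncNorm R ξ)) * V ξ ≤ (∫⁻ ξ, V ξ) +
      ENNReal.ofReal s * (K *
        (∫⁻ ξ, ENNReal.ofReal (Real.exp (s * truncNorm R ξ)) * V ξ) ^ (p + 1)) := by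
  set e : Plane → ℝ≥0∞ := fun ξ => ENNReal.ofReal (Real.exp (s * truncNorm R ξ))
  have he : Measurable e := by fun_prop
  have hsub : ∀ ξ η, e (ξ + η) ≤ e ξ * e η := by
    intro ξ η
    simp only [e]
    rw [← ENNReal.ofReal_mul (Real.exp_pos _).le, ← Real.exp_add, ← mul_add]
    gcongr
    exact truncNorm_add_le hR ξ η
  -- This is `e^t ≤ 1 + t e^t`, equivalent to `1 - t ≤ e^(-t)`, combined with `t ≤ s · weight`.
  have hexp : ∀ ξ, e ξ ≤ 1 + ENNReal.ofReal s * (e ξ * eweight ξ) := by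
    intro ξ
    simp only [e, eweight]
    rw [← ENNReal.ofReal_mul (Real.exp_pos _).le, ← ENNReal.ofReal_mul hs, ← ENNReal.ofReal_one,
      ← ENNReal.ofReal_add zero_le_one (by have := weight_pos ξ; positivity)]
    refine ENNReal.ofReal_le_ofReal ?_
    set t := s * truncNorm R ξ with ht
    have h1 : 1 - t ≤ Real.exp (-t) := by linarith [Real.add_one_le_exp (-t)]
    have h2 : Real.exp t * (1 - t) ≤ 1 := by
      calc Real.exp t * (1 - t) ≤ Real.exp t * Real.exp (-t) := by gcongr
        _ = 1 := by rw [← Real.exp_add]; simp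
    have h3 : Real.exp t * t ≤ s * (Real.exp t * weight ξ) := by
      rw [ht, ← ht, mul_left_comm]
      gcongr
      exact truncNorm_le_weight R ξ
    linarith
  calc ∫⁻ ξ, e ξ * V ξ ≤ ∫⁻ ξ, (V ξ + ENNReal.ofReal s *
        (K * convPow (fun η => e η * V η) volume p ξ)) := by
        refine lintegral_mono_ae ?_
        filter_upwards [hineq] with ξ hξ
        calc e ξ * V ξ ≤ (1 + ENNReal.ofReal s * (e ξ * eweight ξ)) * V ξ := by
              gcongr; exact hexp ξ
          _ = V ξ + ENNReal.ofReal s * (e ξ * (eweight ξ * V ξ)) := by ring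
          _ ≤ V ξ + ENNReal.ofReal s * (e ξ * (K * convPow V volume p ξ)) := by gcongr
          _ = V ξ + ENNReal.ofReal s * (K * (e ξ * convPow V volume p ξ)) := by ring
          _ ≤ _ := by
            gcongr
            exact mul_convPow_le hV hsub p ξ
    _ = _ := by
        have heV : Measurable fun η => e η * V η := he.mul hV
        have hm := measurable_convPow (μ := volume) heV p
        rw [lintegral_add_left hV, lintegral_const_mul _ (by fun_prop),
          lintegral_const_mul _ (by fun_prop), lintegral_convPow heV]

/-- Truncation at `R` makes the exponential moment finite and continuous in `s`. The intermediate
value theorem then keeps it below `2A` up to an `s₀` independent of `R`, and monotone convergence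
removes the truncation. -/
theorem exists_exp_lintegral_lt_top (hV : Measurable V) (hK : K ≠ ⊤)
    (hineq : ∀ᵐ ξ, eweight ξ * V ξ ≤ K * convPow V volume p ξ) (h1 : ∫⁻ ξ, V ξ < ⊤) :
    ∃ s : ℝ, 0 < s ∧ ∫⁻ ξ, ENNReal.ofReal (Real.exp (s * (|ξ.fst| + |ξ.snd|))) * V ξ < ⊤ := by
  set A : ℝ := (∫⁻ ξ, V ξ).toReal + 1 with hA
  have hA0 : 0 < A := by positivity
  -- At the level `Y = 2A` the nonlinear term is at most `s₀ B = A / 2`, so the inequality would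
  -- read `2A ≤ (A - 1) + A / 2`, which is impossible. The `+ 1` in `A` and `B` keeps both positive
  -- when `V` or `K` vanishes.
  set B : ℝ := (K.toReal + 1) * (2 * A) ^ (p + 1) with hB
  have hB0 : 0 < B := by positivity
  set s₀ : ℝ := A / (2 * B) with hs₀
  have hs₀0 : 0 < s₀ := by positivity
  refine ⟨s₀, hs₀0, ?_⟩
  have hVint : Integrable (fun ξ => (V ξ).toReal) :=
    integrable_toReal_of_lintegral_ne_top hV.aemeasurable h1.ne
  have hVae : ∀ᵐ ξ, V ξ < ⊤ := ae_lt_top hV h1.ne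
  have bound : ∀ R : ℝ, 0 ≤ R →
      ∫⁻ ξ, ENNReal.ofReal (Real.exp (s₀ * truncNorm R ξ)) * V ξ ≤ ENNReal.ofReal (2 * A) := by
    intro R hR
    set Y : ℝ → ℝ := fun s => ∫ ξ, Real.exp (s * truncNorm R ξ) * (V ξ).toReal with hY
    have hYb : ∀ s ∈ Set.Icc 0 s₀, ∀ ξ,
        ‖Real.exp (s * truncNorm R ξ) * (V ξ).toReal‖ ≤ Real.exp (s₀ * R) * (V ξ).toReal := by
      intro s hs ξ
      rw [Real.norm_of_nonneg (by positivity)]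
      gcongr
      · exact truncNorm_nonneg hR ξ
      · exact hs.2
      · exact min_le_right _ _
    have hYc : ContinuousOn Y (Set.Icc 0 s₀) := by
      refine continuousOn_of_dominated (bound := fun ξ => Real.exp (s₀ * R) * (V ξ).toReal)
        (fun s _ => by fun_prop) (fun s hs => Eventually.of_forall (hYb s hs))
        (hVint.const_mul _) (Eventually.of_forall fun ξ => by fun_prop)
    have hYy : ∀ s ∈ Set.Icc 0 s₀,
        ∫⁻ ξ, ENNReal.ofReal (Real.exp (s * truncNorm R ξ)) * V ξ = ENNReal.ofReal (Y s) := by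
      intro s hs
      rw [hY, ofReal_integral_eq_lintegral_ofReal
        ((hVint.const_mul (Real.exp (s₀ * R))).mono' (by fun_prop)
          (Eventually.of_forall (hYb s hs)))
        (Eventually.of_forall fun ξ => by positivity)]
      refine lintegral_congr_ae ?_
      filter_upwards [hVae] with ξ hξ
      rw [ENNReal.ofReal_mul (Real.exp_pos _).le, ENNReal.ofReal_toReal hξ.ne]
    have hYnn : ∀ s, 0 ≤ Y s := fun s => integral_nonneg fun ξ => by positivity
    have hYineq : ∀ s ∈ Set.Icc 0 s₀, Y s ≤ (A - 1) + s * (K.toReal * Y s ^ (p + 1)) := by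
      intro s hs
      have := exp_weighted_lintegral_le hV hineq hR hs.1
      rw [hYy s hs, ← ENNReal.ofReal_toReal h1.ne, ← ENNReal.ofReal_toReal hK,
        ← ENNReal.ofReal_pow (hYnn s), ← ENNReal.ofReal_mul (by positivity),
        ← ENNReal.ofReal_mul hs.1, ← ENNReal.ofReal_add (by positivity)
          (mul_nonneg hs.1 (mul_nonneg (by positivity) (pow_nonneg (hYnn s) _)))] at this
      rw [ENNReal.ofReal_le_ofReal_iff (add_nonneg (by positivity)
          (mul_nonneg hs.1 (mul_nonneg (by positivity) (pow_nonneg (hYnn s) _))))] at this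
      rw [hA]
      linarith
    rw [hYy s₀ ⟨hs₀0.le, le_rfl⟩]
    refine ENNReal.ofReal_le_ofReal ?_
    by_contra! hcon
    have hY0 : Y 0 ≤ 2 * A := by
      have := hYineq 0 ⟨le_rfl, hs₀0.le⟩
      linarith
    obtain ⟨s, hs, hsY⟩ := intermediate_value_Icc hs₀0.le hYc ⟨hY0, hcon.le⟩
    have h2 := hYineq s hs
    rw [hsY] at h2
    have h3 : s * (K.toReal * (2 * A) ^ (p + 1)) ≤ s₀ * B := by
      rw [hB]
      have : (0 : ℝ) ≤ (2 * A) ^ (p + 1) := by positivity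
      refine mul_le_mul hs.2 ?_ (by positivity) hs₀0.le
      gcongr
      linarith
    have h4 : s₀ * B = A / 2 := by rw [hs₀]; field_simp
    linarith
  have hmono := lintegral_tendsto_of_tendsto_of_monotone (μ := volume)
    (f := fun (n : ℕ) (ξ : Plane) => ENNReal.ofReal (Real.exp (s₀ * truncNorm n ξ)) * V ξ)
    (F := fun ξ => ENNReal.ofReal (Real.exp (s₀ * (|ξ.fst| + |ξ.snd|))) * V ξ)
    (fun n => by fun_prop)
    (Eventually.of_forall fun ξ n m hnm => by
      simp only
      gcongr
      exact min_le_min_left _ (by exact_mod_cast hnm))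
    (Eventually.of_forall fun ξ => by
      refine tendsto_const_nhds.congr' ?_
      obtain ⟨N, hN⟩ := exists_nat_ge (|ξ.fst| + |ξ.snd|)
      filter_upwards [eventually_ge_atTop N] with n hn
      rw [truncNorm, min_eq_left (hN.trans (by exact_mod_cast hn))])
  exact (le_of_tendsto' hmono fun n => bound n n.cast_nonneg).trans_lt ENNReal.ofReal_lt_top

end Bootstrap

/-! ### Fourier transforms of products of Schwartz functions. -/

section SchwartzProducts

variable {E : Type*} [NormedAddCommGroup E] [InnerProductSpace ℝ E] [FiniteDimensional ℝ E]
  [MeasurableSpace E] [BorelSpace E]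

/-- The pointwise product of Schwartz functions. -/
def schwartzMul (f g : 𝓢(E, ℂ)) : 𝓢(E, ℂ) := SchwartzMap.pairing (ContinuousLinearMap.mul ℂ ℂ) f g

theorem schwartzMul_apply (f g : 𝓢(E, ℂ)) (x : E) : schwartzMul f g x = f x * g x := by
  simp [schwartzMul, SchwartzMap.pairing_apply_apply]

theorem enorm_fourierInv_mul_le (f g : 𝓢(E, ℂ)) (ξ : E) :
    ‖𝓕⁻ (schwartzMul f g) ξ‖ₑ ≤
      lconvolution (fun η => ‖𝓕⁻ f η‖ₑ) (fun η => ‖𝓕⁻ g η‖ₑ) volume ξ := by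
  have h : 𝓕⁻ (schwartzMul f g) =
      SchwartzMap.convolution (ContinuousLinearMap.mul ℂ ℂ) (𝓕⁻ f) (𝓕⁻ g) := by
    simp [schwartzMul, SchwartzMap.convolution]
  rw [h, SchwartzMap.convolution_apply, convolution_def, lconvolution_def]
  refine (enorm_integral_le_lintegral_enorm _).trans_eq ?_
  refine lintegral_congr fun η => ?_
  simp [neg_add_eq_sub]

/-- The pointwise power `f ^ (n + 1)` of a Schwartz function. -/
def schwartzPow (f : 𝓢(E, ℂ)) : ℕ → 𝓢(E, ℂ)
  | 0 => f
  | n + 1 => schwartzMul f (schwartzPow f n)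

theorem schwartzPow_apply (f : 𝓢(E, ℂ)) (n : ℕ) (x : E) : schwartzPow f n x = f x ^ (n + 1) := by
  induction n with
  | zero => simp [schwartzPow]
  | succ n ih => rw [schwartzPow, schwartzMul_apply, ih, ← pow_succ']

theorem enorm_fourierInv_schwartzPow_le (f : 𝓢(E, ℂ)) (n : ℕ) (ξ : E) :
    ‖𝓕⁻ (schwartzPow f n) ξ‖ₑ ≤ convPow (fun η => ‖𝓕⁻ f η‖ₑ) volume n ξ := by
  induction n generalizing ξ with
  | zero => exact le_rfl
  | succ n ih =>
    refine (enorm_fourierInv_mul_le _ _ ξ).trans ?_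
    simp only [convPow, lconvolution_def]
    gcongr
    exact ih _

theorem lintegral_enorm_sq_eq (f : 𝓢(E, ℂ)) :
    ∫⁻ x, ‖f x‖ₑ ^ 2 = ENNReal.ofReal (∫ x, ‖f x‖ ^ 2) := by
  rw [ofReal_integral_eq_lintegral_ofReal]
  · refine lintegral_congr fun x => ?_
    rw [ENNReal.ofReal_pow (norm_nonneg _), ofReal_norm]
  · exact (f.memLp 2 volume).integrable_norm_pow (by norm_num)
  · exact Eventually.of_forall fun x => by positivity

theorem integral_norm_sq_fourierInv (f : 𝓢(E, ℂ)) :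
    ∫ ξ, ‖𝓕⁻ f ξ‖ ^ 2 = ∫ x, ‖f x‖ ^ 2 := by
  have h := SchwartzMap.integral_norm_sq_fourier (𝓕⁻ f)
  rw [FourierTransform.fourier_fourierInv_eq] at h
  exact h.symm

theorem lintegral_enorm_sq_fourierInv (f : 𝓢(E, ℂ)) :
    ∫⁻ ξ, ‖𝓕⁻ f ξ‖ₑ ^ 2 = ∫⁻ x, ‖f x‖ₑ ^ 2 := by
  rw [lintegral_enorm_sq_eq, lintegral_enorm_sq_eq, integral_norm_sq_fourierInv]

end SchwartzProducts

/-! ### The space `𝒵` on the Fourier side and its embedding into `L⁴`. -/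

/-- The anisotropic Sobolev embedding into `L⁴`. -/
theorem exists_lintegral_pow_four_le :
    ∃ C : ℝ≥0∞, C ≠ ⊤ ∧ ∀ f : 𝓢(Plane, ℂ),
      ∫⁻ x, ‖f x‖ₑ ^ 4 ≤ C * (∫⁻ ξ, eweight ξ * ‖𝓕⁻ f ξ‖ₑ ^ 2) ^ 2 := by
  refine ⟨recipNorm (1 / 4) (fun ξ => eweight ξ ^ (-(1 / 2) : ℝ)) volume ^ 4,
    (ENNReal.pow_lt_top (recipNorm_eweight_lt_top (by norm_num) (by norm_num))).ne, fun f => ?_⟩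
  have hm : Measurable (fun ξ => ‖𝓕⁻ f ξ‖ₑ) := (𝓕⁻ f).continuous.enorm.measurable
  -- By Plancherel `‖f‖₄⁴ = ‖f²‖₂²` is at most the squared `L²` norm of the self-convolution of `|𝓕⁻
  -- f|`, and `3/4 + 3/4 - 1 = 1/2` in Young's inequality. The exponent `3/4` lies below the
  -- threshold `5/6`.
  have h1 := recipNorm_convPow_le (μ := (volume : Measure Plane)) (a := 3 / 4) (by norm_num) hm 1
    (by norm_num)
  have h2 := recipNorm_le_weighted hm (a := 3 / 4) (by norm_num)
  norm_num at h1 h2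
  have h3 : ∫⁻ x, ‖f x‖ₑ ^ 4 ≤
      recipNorm (1 / 2) (convPow (fun ξ => ‖𝓕⁻ f ξ‖ₑ) volume 1) volume ^ 2 := by
    unfold recipNorm
    rw [← ENNReal.rpow_mul_natCast]
    norm_num
    calc ∫⁻ x, ‖f x‖ₑ ^ 4 = ∫⁻ x, ‖schwartzPow f 1 x‖ₑ ^ 2 := by
          refine lintegral_congr fun x => ?_
          rw [schwartzPow_apply, enorm_pow, ← pow_mul]
      _ = ∫⁻ ξ, ‖𝓕⁻ (schwartzPow f 1) ξ‖ₑ ^ 2 := (lintegral_enorm_sq_fourierInv _).symm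
      _ ≤ _ := by
          gcongr with ξ
          exact enorm_fourierInv_schwartzPow_le f 1 ξ
  calc ∫⁻ x, ‖f x‖ₑ ^ 4 ≤ (recipNorm (3 / 4) (fun ξ => ‖𝓕⁻ f ξ‖ₑ) volume ^ 2) ^ 2 := by
        refine h3.trans ?_
        gcongr
    _ ≤ ((recipNorm (1 / 4) (fun ξ => eweight ξ ^ (-(1 / 2) : ℝ)) volume *
          (∫⁻ ξ, eweight ξ * ‖𝓕⁻ f ξ‖ₑ ^ 2) ^ (1 / 2 : ℝ)) ^ 2) ^ 2 := by
        gcongr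
    _ = _ := by
        rw [mul_pow, mul_pow, ← pow_mul, ← ENNReal.rpow_mul_natCast]
        norm_num

/-- A real function on `ℝ × ℝ`, regarded as a complex function on the Euclidean plane. -/
def lift (ψ : ℝ × ℝ → ℝ) (x : Plane) : ℂ := (ψ x.ofLp : ℂ)

theorem contDiff_plane_ofLp {n : WithTop ℕ∞} :
    ContDiff ℝ n (WithLp.ofLp : Plane → ℝ × ℝ) :=
  (WithLp.prodContinuousLinearEquiv 2 ℝ ℝ ℝ).contDiff

theorem IsTest.contDiff_lift {ψ : ℝ × ℝ → ℝ} (h : IsTest ψ) : ContDiff ℝ (⊤ : ℕ∞) (lift ψ) :=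
  Complex.ofRealCLM.contDiff.comp (h.1.comp contDiff_plane_ofLp)

theorem IsTest.hasCompactSupport_lift {ψ : ℝ × ℝ → ℝ} (h : IsTest ψ) :
    HasCompactSupport (lift ψ) :=
  (h.2.comp_homeomorph (WithLp.prodContinuousLinearEquiv 2 ℝ ℝ ℝ).toHomeomorph).comp_left
    (g := fun r : ℝ => (r : ℂ)) Complex.ofReal_zero

/-- A test function as a complex Schwartz function on the Euclidean plane. -/
def IsTest.toSchwartz {ψ : ℝ × ℝ → ℝ} (h : IsTest ψ) : 𝓢(Plane, ℂ) :=
  h.hasCompactSupport_lift.toSchwartzMap h.contDiff_lift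

theorem IsTest.toSchwartz_apply {ψ : ℝ × ℝ → ℝ} (h : IsTest ψ) (x : Plane) :
    h.toSchwartz x = (ψ x.ofLp : ℂ) := rfl

theorem IsTest.sub {ψ χ : ℝ × ℝ → ℝ} (h : IsTest ψ) (h' : IsTest χ) : IsTest (ψ - χ) :=
  ⟨h.1.sub h'.1, by
    have := h.2.sub h'.2
    exact this⟩

theorem IsTest.toSchwartz_sub {ψ χ : ℝ × ℝ → ℝ} (h : IsTest ψ) (h' : IsTest χ) :
    (h.sub h').toSchwartz = h.toSchwartz - h'.toSchwartz := by
  ext x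
  simp [IsTest.toSchwartz_apply]

theorem integral_plane_eq {F : Type*} [NormedAddCommGroup F] [NormedSpace ℝ F] (g : ℝ × ℝ → F) :
    ∫ x : Plane, g x.ofLp = ∫ z, g z :=
  measurePreserving_ofLp.integral_comp measurableEmbedding_ofLp g

theorem IsTest.lineDeriv_toSchwartz {ψ : ℝ × ℝ → ℝ} (h : IsTest ψ) (x : Plane) :
    (∂_{(WithLp.toLp 2 ((0 : ℝ), (1 : ℝ)) : Plane)} h.toSchwartz) x
      = (partialY ψ x.ofLp : ℂ) := by
  rw [SchwartzMap.lineDerivOp_apply, lineDeriv, partialY]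
  have hd : HasDerivAt (fun y : ℝ => ψ (x.ofLp.1, y)) (deriv (fun y : ℝ => ψ (x.ofLp.1, y)) x.ofLp.2)
      x.ofLp.2 := by
    refine DifferentiableAt.hasDerivAt ?_
    have : Differentiable ℝ ψ := h.1.differentiable (by simp)
    fun_prop
  have hd2 : HasDerivAt (fun t : ℝ => ψ (x.ofLp.1, x.ofLp.2 + t))
      (deriv (fun y : ℝ => ψ (x.ofLp.1, y)) x.ofLp.2) 0 := by
    have h0 : x.ofLp.2 + 0 = x.ofLp.2 := add_zero _
    exact HasDerivAt.comp_const_add (f := fun y : ℝ => ψ (x.ofLp.1, y)) x.ofLp.2 0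
      (by rw [h0]; exact hd)
  refine HasDerivAt.deriv ?_
  have := hd2.ofReal_comp
  refine this.congr_deriv rfl |>.congr_of_eventuallyEq (Eventually.of_forall fun t => ?_)
  simp only [IsTest.toSchwartz_apply]
  congr 2
  ext <;> simp

theorem fourierInv_lineDeriv_snd (f : 𝓢(Plane, ℂ)) (ξ : Plane) :
    𝓕⁻ (∂_{(WithLp.toLp 2 ((0 : ℝ), (1 : ℝ)) : Plane)} f) ξ =
      -(2 * Real.pi * Complex.I) * (ξ.snd * 𝓕⁻ f ξ) := by
  have hg : (fun x : Plane => inner ℝ x (WithLp.toLp 2 ((0 : ℝ), (1 : ℝ)) : Plane)).HasTemperateGrowth := by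
    fun_prop
  have hs : (fun x : Plane => x.snd).HasTemperateGrowth := by simpa using hg
  rw [SchwartzMap.fourierInv_lineDerivOp_eq]
  simp [SchwartzMap.smulLeftCLM_apply_apply hs]

theorem fourierInv_toSchwartz_eq {ψ : ℝ × ℝ → ℝ} (h : IsTest ψ) (η : Plane) :
    𝓕⁻ h.toSchwartz η = fourierR2 ψ ((-2 * Real.pi) • η.ofLp) := by
  rw [SchwartzMap.fourierInv_coe, Real.fourierInv_eq', fourierR2,
    ← integral_plane_eq]
  congr 1
  ext x
  rw [smul_eq_mul, h.toSchwartz_apply]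
  congr 2
  simp [WithLp.prod_inner_apply]
  ring

/-- Plancherel in each of the three terms. The two Fourier normalizations differ by the dilation
`-2π`, which puts the factors `2π` and `(2π)²` in front of the `|ξ₁|` and `ξ₂²` terms; both exceed
`1`, hence an inequality. -/
theorem IsTest.integral_weight_le {ψ : ℝ × ℝ → ℝ} (h : IsTest ψ) :
    Integrable (fun ξ => weight ξ * ‖𝓕⁻ h.toSchwartz ξ‖ ^ 2) ∧
    ∫ ξ, weight ξ * ‖𝓕⁻ h.toSchwartz ξ‖ ^ 2 ≤ zNorm ψ ^ 2 := by
  set f := h.toSchwartz with hf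
  have i0 : Integrable (fun ξ => ‖𝓕⁻ f ξ‖ ^ 2) :=
    ((𝓕⁻ f).memLp 2 volume).integrable_norm_pow (by norm_num)
  set d := (∂_{(WithLp.toLp 2 ((0 : ℝ), (1 : ℝ)) : Plane)} f)
  have hd : ∀ ξ, ‖𝓕⁻ d ξ‖ ^ 2 = (2 * Real.pi) ^ 2 * (ξ.snd ^ 2 * ‖𝓕⁻ f ξ‖ ^ 2) := by
    intro ξ
    rw [fourierInv_lineDeriv_snd]
    simp [mul_pow, abs_of_pos Real.pi_pos]
  have i2 : Integrable (fun ξ : Plane => ξ.snd ^ 2 * ‖𝓕⁻ f ξ‖ ^ 2) := by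
    have : Integrable (fun ξ => ‖𝓕⁻ d ξ‖ ^ 2) :=
      ((𝓕⁻ d).memLp 2 volume).integrable_norm_pow (by norm_num)
    simp_rw [hd] at this
    exact (integrable_const_mul_iff (by simp [Real.pi_ne_zero]) _).1 this
  have i1 : Integrable (fun ξ : Plane => |ξ.fst| * ‖𝓕⁻ f ξ‖ ^ 2) := by
    obtain ⟨C, hC⟩ : ∃ C, ∀ ξ, ‖𝓕⁻ f ξ‖ ≤ C :=
      ⟨_, fun ξ => SchwartzMap.norm_le_seminorm ℝ (𝓕⁻ f) ξ⟩
    have : Integrable (fun ξ => C * (‖ξ‖ ^ 1 * ‖𝓕⁻ f ξ‖)) :=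
      ((𝓕⁻ f).integrable_pow_mul volume 1).const_mul C
    refine this.mono' ?_ (Eventually.of_forall fun ξ => ?_)
    · exact (continuous_plane_fst.abs.mul
        ((𝓕⁻ f).continuous.norm.pow 2)).aestronglyMeasurable
    · rw [Real.norm_of_nonneg (by positivity), pow_one, pow_two, ← mul_assoc]
      have h1 : |ξ.fst| ≤ ‖ξ‖ := WithLp.norm_fst_le _ ξ
      calc |ξ.fst| * ‖𝓕⁻ f ξ‖ * ‖𝓕⁻ f ξ‖ ≤ ‖ξ‖ * ‖𝓕⁻ f ξ‖ * C := by
            gcongr; exact hC ξ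
        _ = _ := by ring
  have e : ∀ ξ, weight ξ * ‖𝓕⁻ f ξ‖ ^ 2 = (‖𝓕⁻ f ξ‖ ^ 2 + |ξ.fst| * ‖𝓕⁻ f ξ‖ ^ 2) +
      ξ.snd ^ 2 * ‖𝓕⁻ f ξ‖ ^ 2 := by
    intro ξ; unfold weight; ring
  simp_rw [e]
  refine ⟨(i0.add i1).add i2, ?_⟩
  have s0 : ∫ ξ, ‖𝓕⁻ f ξ‖ ^ 2 = ∫ z, ψ z ^ 2 := by
    rw [integral_norm_sq_fourierInv, ← integral_plane_eq]
    congr 1; ext x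
    simp [hf, h.toSchwartz_apply]
  have s2 : (2 * Real.pi) ^ 2 * ∫ ξ : Plane, ξ.snd ^ 2 * ‖𝓕⁻ f ξ‖ ^ 2 = ∫ z, partialY ψ z ^ 2 := by
    rw [← integral_const_mul]
    simp_rw [← hd]
    rw [integral_norm_sq_fourierInv, ← integral_plane_eq]
    congr 1; ext x
    simp [d, hf, h.lineDeriv_toSchwartz]
  have s1 : ((2 * Real.pi) ^ 2)⁻¹ * ∫ ξ : ℝ × ℝ, |ξ.1| * ‖fourierR2 ψ ξ‖ ^ 2 =
      2 * Real.pi * ∫ ξ : Plane, |ξ.fst| * ‖𝓕⁻ f ξ‖ ^ 2 := by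
    -- The Jacobian of the dilation is exactly the prefactor `(2π)⁻²` in `zNorm`, and the factor
    -- `2π` comes from `|ξ₁|`.
    have := Measure.integral_comp_smul (volume : Measure (ℝ × ℝ))
      (fun ξ : ℝ × ℝ => |ξ.1| * ‖fourierR2 ψ ξ‖ ^ 2) (-2 * Real.pi)
    rw [← integral_plane_eq] at this
    simp_rw [← fourierInv_toSchwartz_eq h] at this
    simp only [Prod.smul_fst, smul_eq_mul, abs_mul] at this
    simp_rw [mul_assoc] at this
    rw [integral_const_mul, integral_const_mul] at this
    simp [abs_of_pos Real.pi_pos] at this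
    rw [← this]
    ring
  unfold zNorm
  rw [Real.sq_sqrt (by positivity), s1, ← s2, ← s0]
  have hadd : ∫ ξ : Plane, (‖𝓕⁻ f ξ‖ ^ 2 + |ξ.fst| * ‖𝓕⁻ f ξ‖ ^ 2) + ξ.snd ^ 2 * ‖𝓕⁻ f ξ‖ ^ 2 =
      ((∫ ξ, ‖𝓕⁻ f ξ‖ ^ 2) + ∫ ξ : Plane, |ξ.fst| * ‖𝓕⁻ f ξ‖ ^ 2) +
        ∫ ξ : Plane, ξ.snd ^ 2 * ‖𝓕⁻ f ξ‖ ^ 2 := by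
    rw [← integral_add i0 i1]
    exact integral_add (i0.add i1) i2
  rw [hadd]
  have p1 : 0 ≤ ∫ ξ : Plane, |ξ.fst| * ‖𝓕⁻ f ξ‖ ^ 2 := by positivity
  have p2 : 0 ≤ ∫ ξ : Plane, ξ.snd ^ 2 * ‖𝓕⁻ f ξ‖ ^ 2 := by positivity
  have hpi := Real.pi_gt_three
  have q1 := le_mul_of_one_le_left p1 (by linarith : 1 ≤ 2 * Real.pi)
  have q2 := le_mul_of_one_le_left p2 (by nlinarith : 1 ≤ (2 * Real.pi) ^ 2)
  linarith

theorem IsTest.lintegral_eweight_le {ψ : ℝ × ℝ → ℝ} (h : IsTest ψ) :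
    ∫⁻ ξ, eweight ξ * ‖𝓕⁻ h.toSchwartz ξ‖ₑ ^ 2 ≤ ENNReal.ofReal (zNorm ψ ^ 2) := by
  obtain ⟨h1, h2⟩ := h.integral_weight_le
  refine le_trans (le_of_eq ?_) (ENNReal.ofReal_le_ofReal h2)
  rw [ofReal_integral_eq_lintegral_ofReal h1
    (Eventually.of_forall fun ξ => by have := weight_pos ξ; positivity)]
  refine lintegral_congr fun ξ => ?_
  rw [ENNReal.ofReal_mul (weight_pos ξ).le, ENNReal.ofReal_pow (norm_nonneg _), ofReal_norm]
  rfl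

theorem eLpNorm_two_sq {α E : Type*} [MeasurableSpace α] [NormedAddCommGroup E] (f : α → E)
    (μ : Measure α) : eLpNorm f 2 μ ^ 2 = ∫⁻ x, ‖f x‖ₑ ^ 2 ∂μ := by
  have := eLpNorm_nnreal_pow_eq_lintegral (f := f) (μ := μ) (p := 2) (by norm_num)
  simpa using this

theorem eLpNorm_four_pow {α E : Type*} [MeasurableSpace α] [NormedAddCommGroup E] (f : α → E)
    (μ : Measure α) : eLpNorm f 4 μ ^ 4 = ∫⁻ x, ‖f x‖ₑ ^ 4 ∂μ := by
  have := eLpNorm_nnreal_pow_eq_lintegral (f := f) (μ := μ) (p := 4) (by norm_num)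
  simpa using this

/-- Lebesgue measure with the elliptic weight as density. -/
def weightedVolume : Measure Plane := volume.withDensity eweight

theorem lintegral_weightedVolume {g : Plane → ℝ≥0∞} (hg : Measurable g) :
    ∫⁻ ξ, g ξ ∂weightedVolume = ∫⁻ ξ, eweight ξ * g ξ := by
  rw [weightedVolume, lintegral_withDensity_eq_lintegral_mul _ measurable_eweight hg]
  rfl

theorem exists_fast_cauchy_subseq {z : ℕ → ℕ → ℝ}
    (hz : ∀ δ : ℝ, 0 < δ → ∃ N : ℕ, ∀ m n : ℕ, N ≤ m → N ≤ n → z m n < δ) :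
    ∃ s : ℕ → ℕ, Tendsto s atTop atTop ∧
      ∀ N m n : ℕ, N ≤ m → N ≤ n → z (s m) (s n) < (1 / 2 : ℝ) ^ N := by
  choose M hM using fun k : ℕ => hz ((1 / 2 : ℝ) ^ k) (by positivity)
  -- The partial sums dominate `M N` as soon as `k ≥ N`, and the added ones force them to infinity.
  refine ⟨fun k => ∑ j ∈ Finset.range (k + 1), (M j + 1), ?_, fun N m n hm hn => ?_⟩
  · refine tendsto_atTop_mono (fun k => ?_) tendsto_id
    rw [Finset.sum_add_distrib]
    simp
    omega
  · have key : ∀ m, N ≤ m → M N ≤ ∑ j ∈ Finset.range (m + 1), (M j + 1) := by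
      intro m hm
      exact (Nat.le_succ _).trans (Finset.single_le_sum (f := fun j => M j + 1)
        (fun _ _ => Nat.zero_le _) (Finset.mem_range.2 (by omega)))
    exact hM N _ _ (key m hm) (key n hn)

theorem zNorm_nonneg (ψ : ℝ × ℝ → ℝ) : 0 ≤ zNorm ψ := Real.sqrt_nonneg _

theorem IsTest.eLpNorm_weighted_le {ψ : ℝ × ℝ → ℝ} (h : IsTest ψ) :
    eLpNorm ⇑(𝓕⁻ h.toSchwartz : 𝓢(Plane, ℂ)) 2 weightedVolume ≤ ENNReal.ofReal (zNorm ψ) := by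
  rw [← ENNReal.pow_le_pow_left_iff (n := 2) (by norm_num), eLpNorm_two_sq,
    lintegral_weightedVolume ((𝓕⁻ h.toSchwartz).continuous.enorm.measurable.pow_const 2),
    ← ENNReal.ofReal_pow (zNorm_nonneg ψ)]
  exact h.lintegral_eweight_le

theorem exists_eLpNorm_four_le :
    ∃ C : ℝ≥0∞, C ≠ ⊤ ∧ ∀ (ψ : ℝ × ℝ → ℝ) (h : IsTest ψ),
      eLpNorm h.toSchwartz 4 volume ≤ C * ENNReal.ofReal (zNorm ψ) := by
  obtain ⟨C, hC, hle⟩ := exists_lintegral_pow_four_le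
  refine ⟨C ^ (1 / 4 : ℝ), ENNReal.rpow_ne_top_of_nonneg (by norm_num) hC, fun ψ h => ?_⟩
  rw [← ENNReal.pow_le_pow_left_iff (n := 4) (by norm_num), eLpNorm_four_pow]
  refine (hle _).trans ?_
  rw [mul_pow, ← ENNReal.rpow_mul_natCast, ← ENNReal.ofReal_pow (zNorm_nonneg ψ)]
  norm_num
  gcongr
  refine (pow_le_pow_left₀ zero_le h.lintegral_eweight_le 2).trans_eq ?_
  rw [← ENNReal.ofReal_pow (by positivity), ← pow_mul]

theorem eLpNorm_toSchwartz_sub_lift {φ ψ : ℝ × ℝ → ℝ} (h : IsTest ψ)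
    (hφ : AEStronglyMeasurable φ) :
    eLpNorm (⇑h.toSchwartz - lift φ) 2 volume = eLpNorm (ψ - φ) 2 volume := by
  rw [← eLpNorm_comp_measurePreserving (h.1.continuous.aestronglyMeasurable.sub hφ)
    measurePreserving_ofLp]
  refine eLpNorm_congr_norm_ae (Eventually.of_forall fun x => ?_)
  simp only [Pi.sub_apply, h.toSchwartz_apply, lift, ← Complex.ofReal_sub, Complex.norm_real,
    Function.comp]

theorem aestronglyMeasurable_lift {φ : ℝ × ℝ → ℝ} (hφ : AEStronglyMeasurable φ) :
    AEStronglyMeasurable (lift φ) :=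
  Complex.continuous_ofReal.comp_aestronglyMeasurable
    (hφ.comp_measurePreserving measurePreserving_ofLp)

theorem fourierInv_schwartz_sub (f g : 𝓢(Plane, ℂ)) : 𝓕⁻ (f - g) = 𝓕⁻ f - 𝓕⁻ g := by
  rw [sub_eq_add_neg, FourierTransform.fourierInv_add, FourierTransform.fourierInv_neg,
    sub_eq_add_neg]

theorem tsum_half_pow_ne_top : ∑' k : ℕ, (2⁻¹ : ℝ≥0∞) ^ k ≠ ⊤ := by
  rw [ENNReal.tsum_geometric]
  norm_num

/-! ### Approximation of functions of `𝒵` at a geometric rate. -/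

/-- Functions of `𝒵` are limits of Schwartz functions, in `L²`, in `L⁴`, and in the weighted
space on the Fourier side. -/
theorem MemZ.exists_approx {φ : ℝ × ℝ → ℝ} (h : MemZ φ) :
    ∃ (f : ℕ → 𝓢(Plane, ℂ)) (U : Plane → ℂ), Measurable U ∧
      ∫⁻ ξ, eweight ξ * ‖U ξ‖ₑ ^ 2 < ⊤ ∧
      (∀ k, ∫⁻ x, ‖f k x - lift φ x‖ₑ ^ 2 ≤ 2⁻¹ ^ k) ∧
      (∀ k, ∫⁻ x, ‖f k x - lift φ x‖ₑ ^ 4 ≤ 2⁻¹ ^ k) ∧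
      (∀ k, ∫⁻ ξ, eweight ξ * ‖𝓕⁻ (f k) ξ - U ξ‖ₑ ^ 2 ≤ 2⁻¹ ^ k) := by
  obtain ⟨hφ, ψ, htest, hcau, hlim⟩ := h
  obtain ⟨s, hs, hcau⟩ := exists_fast_cauchy_subseq hcau
  set f : ℕ → 𝓢(Plane, ℂ) := fun n => (htest (s n)).toSchwartz with hf
  have hB : ∑' k : ℕ, ENNReal.ofReal ((1 / 2 : ℝ) ^ k) ≠ ⊤ := by
    simp_rw [ENNReal.ofReal_pow (by norm_num : (0 : ℝ) ≤ 1 / 2)]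
    rw [ENNReal.ofReal_div_of_pos two_pos]
    simp
  have hdiff : ∀ n m, f n - f m = ((htest (s n)).sub (htest (s m))).toSchwartz :=
    fun n m => (IsTest.toSchwartz_sub _ _).symm
  have hlt : ∀ N n m, N ≤ n → N ≤ m → ENNReal.ofReal (zNorm (ψ (s n) - ψ (s m))) <
      ENNReal.ofReal ((1 / 2 : ℝ) ^ N) := fun N n m hn hm =>
    (ENNReal.ofReal_lt_ofReal_iff (by positivity)).2 (hcau N n m hn hm)
  obtain ⟨U₀, hU₀, hUlim⟩ := Lp.cauchy_complete_eLpNorm (p := 2) (μ := weightedVolume)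
    (by norm_num) (f := fun n => ⇑(𝓕⁻ (f n) : 𝓢(Plane, ℂ))) (fun n => ⟨(𝓕⁻ (f n)).continuous.aestronglyMeasurable, by
      exact (htest (s n)).eLpNorm_weighted_le.trans_lt ENNReal.ofReal_lt_top⟩) hB
    (fun N n m hn hm => by
      refine lt_of_le_of_lt (le_of_eq_of_le ?_
        ((htest (s n)).sub (htest (s m))).eLpNorm_weighted_le) (hlt N n m hn hm)
      rw [← hdiff]
      rw [fourierInv_schwartz_sub]
      rfl)
  obtain ⟨C, hC, hC4⟩ := exists_eLpNorm_four_le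
  obtain ⟨g, hg, hglim⟩ := Lp.cauchy_complete_eLpNorm (p := 4) (μ := (volume : Measure Plane))
    (by norm_num) (f := fun n => (f n : Plane → ℂ)) (fun n => (f n).memLp 4 volume)
    -- With `C + 1` in place of `C` the factor is nonzero, so multiplying by it preserves the strict
    -- inequality.
    (B := fun N => (C + 1) * ENNReal.ofReal ((1 / 2 : ℝ) ^ N))
    (by rw [ENNReal.tsum_mul_left]; exact ENNReal.mul_ne_top (by simp [hC]) hB)
    (fun N n m hn hm => by
      have h1 := hC4 _ ((htest (s n)).sub (htest (s m)))
      rw [← hdiff] at h1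
      calc eLpNorm (⇑(f n) - ⇑(f m)) 4 volume ≤ (C + 1) * ENNReal.ofReal _ :=
            h1.trans (by gcongr; exact le_self_add)
        _ < _ := ENNReal.mul_lt_mul_right (by simp) (by simp [hC]) (hlt N n m hn hm))
  have hmeas : AEStronglyMeasurable (lift φ) := aestronglyMeasurable_lift hφ.1
  have hlim2 : Tendsto (fun n => eLpNorm (⇑(f n) - lift φ) 2 volume) atTop (𝓝 0) := by
    simp_rw [hf, eLpNorm_toSchwartz_sub_lift (htest _) hφ.1]
    exact hlim.comp hs
  -- The `L⁴` and `L²` limits of the same sequence are both limits in measure, hence agree.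
  have hgae : g =ᵐ[volume] lift φ := by
    refine tendstoInMeasure_ae_unique
      (tendstoInMeasure_of_tendsto_eLpNorm (by norm_num)
        (fun n => (f n).continuous.aestronglyMeasurable) hg.1 hglim)
      (tendstoInMeasure_of_tendsto_eLpNorm (by norm_num)
        (fun n => (f n).continuous.aestronglyMeasurable) hmeas hlim2)
  have hlim4 : Tendsto (fun n => eLpNorm (⇑(f n) - lift φ) 4 volume) atTop (𝓝 0) := by
    refine hglim.congr fun n => eLpNorm_congr_ae ?_
    filter_upwards [hgae] with x hx
    simp [hx]
  set U : Plane → ℂ := hU₀.1.mk U₀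
  have hUm : Measurable U := hU₀.1.stronglyMeasurable_mk.measurable
  have hUlim' : Tendsto (fun n => eLpNorm (⇑(𝓕⁻ (f n) : 𝓢(Plane, ℂ)) - U) 2 weightedVolume) atTop
      (𝓝 0) := by
    refine hUlim.congr fun n => eLpNorm_congr_ae ?_
    filter_upwards [hU₀.1.ae_eq_mk] with x hx
    simp only [Pi.sub_apply, hx, U]
  have hUfin : ∫⁻ ξ, eweight ξ * ‖U ξ‖ₑ ^ 2 < ⊤ := by
    rw [← lintegral_weightedVolume (by fun_prop), ← eLpNorm_two_sq]
    exact ENNReal.pow_lt_top ((eLpNorm_congr_ae hU₀.1.ae_eq_mk).symm.trans_lt hU₀.2)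
  have ev : ∀ k : ℕ, ∃ n, ∫⁻ x, ‖f n x - lift φ x‖ₑ ^ 2 ≤ 2⁻¹ ^ k ∧
      ∫⁻ x, ‖f n x - lift φ x‖ₑ ^ 4 ≤ 2⁻¹ ^ k ∧
      ∫⁻ ξ, eweight ξ * ‖𝓕⁻ (f n) ξ - U ξ‖ₑ ^ 2 ≤ 2⁻¹ ^ k := by
    intro k
    have hk : (0 : ℝ≥0∞) < 2⁻¹ ^ k := ENNReal.pow_pos (by simp) k
    have t2 := ((ENNReal.continuous_pow 2).tendsto 0).comp hlim2
    have t4 := ((ENNReal.continuous_pow 4).tendsto 0).comp hlim4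
    have tU := ((ENNReal.continuous_pow 2).tendsto 0).comp hUlim'
    simp only [Function.comp_def, eLpNorm_two_sq, eLpNorm_four_pow, Pi.sub_apply, ne_eq,
      OfNat.ofNat_ne_zero, not_false_eq_true, zero_pow] at t2 t4 tU
    obtain ⟨n, h2, h4, hU⟩ := ((t2.eventually_le_const hk).and ((t4.eventually_le_const hk).and
      (tU.eventually_le_const hk))).exists
    refine ⟨n, h2, h4, ?_⟩
    rwa [lintegral_weightedVolume
      (((𝓕⁻ (f n)).continuous.measurable.sub hUm).enorm.pow_const 2)] at hU
  choose n h2 h4 hU using ev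
  exact ⟨fun k => f (n k), U, hUm, hUfin, h2, h4, hU⟩

/-! ### Passing to the limit in convolution powers and in powers of functions. -/

theorem lt_top_ae_of_recipNorm {G : Type*} [MeasurableSpace G] {μ : Measure G} {a : ℝ}
    (ha : 0 < a) {f : G → ℝ≥0∞} (hf : Measurable f) (h : recipNorm a f μ < ⊤) :
    ∀ᵐ x ∂μ, f x < ⊤ := by
  have h1 : ∫⁻ x, f x ^ (1 / a) ∂μ ≠ ⊤ := by
    intro h2
    rw [recipNorm, h2, ENNReal.top_rpow_of_pos ha] at h
    exact lt_irrefl _ h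
  filter_upwards [ae_lt_top (hf.pow_const _) h1] with x hx
  exact (ENNReal.rpow_lt_top_iff_of_pos (by positivity)).1 hx

/-- With `a = 4/5` the exponent `(n + 1) a - n` left by Young is at least `1/5` for `n ≤ 3`. -/
theorem convPow_lt_top_ae {W : Plane → ℝ≥0∞} (hW : Measurable W)
    (h : ∫⁻ ξ, eweight ξ * W ξ ^ 2 < ⊤) {n : ℕ} (hn : n < 4) :
    ∀ᵐ ξ, convPow W volume n ξ < ⊤ := by
  have h0 : recipNorm (4 / 5) W volume < ⊤ :=
    recipNorm_lt_top_of_weighted hW h (by norm_num) (by norm_num)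
  have hn' : (n : ℝ) ≤ 3 := by exact_mod_cast Nat.lt_succ_iff.1 hn
  exact lt_top_ae_of_recipNorm (a := (n + 1) * (4 / 5) - n) (by linarith) (measurable_convPow hW n)
    ((recipNorm_convPow_le (by norm_num) hW n (by linarith)).trans_lt (ENNReal.pow_lt_top h0))

/-- Dominated convergence for convolution powers. -/
theorem tendsto_convPow {g : ℕ → Plane → ℝ≥0∞} {V W : Plane → ℝ≥0∞} (hg : ∀ k, Measurable (g k))
    (hW : Measurable W) (hfin : ∫⁻ ξ, eweight ξ * W ξ ^ 2 < ⊤)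
    (hle : ∀ k ξ, g k ξ ≤ W ξ) (hlim : ∀ᵐ ξ, Tendsto (fun k => g k ξ) atTop (𝓝 (V ξ)))
    (n : ℕ) (hn : n < 4) :
    ∀ᵐ ξ, Tendsto (fun k => convPow (g k) volume n ξ) atTop (𝓝 (convPow V volume n ξ)) := by
  -- Multiplication on `ℝ≥0∞` is discontinuous at `0 · ∞`, so convergence of the products requires
  -- finite limits.
  have fin_lim : ∀ m, m < 4 → (∀ᵐ ξ, Tendsto (fun k => convPow (g k) volume m ξ) atTop
      (𝓝 (convPow V volume m ξ))) → ∀ᵐ ξ, convPow V volume m ξ < ⊤ := by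
    intro m hm h
    filter_upwards [h, convPow_lt_top_ae hW hfin hm] with ξ h1 h2
    exact (le_of_tendsto' h1 fun k => convPow_mono (hle k) m ξ).trans_lt h2
  have hVfin : ∀ᵐ ξ, V ξ < ⊤ := fin_lim 0 (by norm_num) hlim
  induction n with
  | zero => exact hlim
  | succ n ih =>
    have hlim_n := ih (by omega)
    have hfin_n := fin_lim n (by omega) hlim_n
    filter_upwards [convPow_lt_top_ae hW hfin hn] with ξ hξ
    simp only [convPow, lconvolution_def] at hξ ⊢
    have qmp : Measure.QuasiMeasurePreserving (fun η : Plane => -η + ξ) volume volume :=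
      ((measurePreserving_add_right volume ξ).comp
        (Measure.measurePreserving_neg volume)).quasiMeasurePreserving
    refine tendsto_lintegral_of_dominated_convergence
      (fun η => W η * convPow W volume n (-η + ξ)) (fun k => ?_) (fun k => ?_) hξ.ne ?_
    · have := hg k
      have := measurable_convPow (μ := volume) (hg k) n
      fun_prop
    · exact Eventually.of_forall fun η => mul_le_mul' (hle k η) (convPow_mono (hle k) n _)
    · filter_upwards [hlim, hVfin, qmp.ae hlim_n, qmp.ae hfin_n] with η h1 h2 h3 h4
      exact ENNReal.Tendsto.mul h1 (Or.inr h4.ne) h3 (Or.inr h2.ne)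

theorem tendsto_of_tsum_pow_lt_top {E : Type*} [NormedAddCommGroup E] {f : ℕ → E} {a : E} {m : ℕ}
    (h : ∑' k, ‖f k - a‖ₑ ^ (m + 1) < ⊤) : Tendsto f atTop (𝓝 a) := by
  rw [tendsto_iff_edist_tendsto_0]
  simp_rw [edist_eq_enorm_sub]
  have h1 := ENNReal.tendsto_atTop_zero_of_tsum_ne_top h.ne
  have h2 := ((ENNReal.continuous_rpow_const (y := ((m + 1 : ℕ) : ℝ)⁻¹)).tendsto 0).comp h1
  rw [ENNReal.zero_rpow_of_pos (by positivity)] at h2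
  refine h2.congr fun k => ?_
  simp only [Function.comp]
  rw [← ENNReal.rpow_natCast, ENNReal.rpow_rpow_inv (by positivity)]

theorem lintegral_tsum_lt_top_of_le_half_pow {α : Type*} [MeasurableSpace α] {μ : Measure α}
    {F : ℕ → α → ℝ≥0∞} (hF : ∀ k, AEMeasurable (F k) μ) (h : ∀ k, ∫⁻ x, F k x ∂μ ≤ 2⁻¹ ^ k) :
    ∫⁻ x, ∑' k, F k x ∂μ < ⊤ := by
  rw [lintegral_tsum hF]
  exact (ENNReal.tsum_le_tsum h).trans_lt tsum_half_pow_ne_top.lt_top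

/-- Thanks to the summable errors, `|U| + (∑ |u_k - U|²)^(1/2)` dominates the whole sequence, still
lies in the weighted space, and its finiteness forces convergence almost everywhere. -/
theorem tendsto_convPow_of_weighted {u : ℕ → Plane → ℂ} {U : Plane → ℂ}
    (hu : ∀ k, Measurable (u k)) (hU : Measurable U)
    (hfin : ∫⁻ ξ, eweight ξ * ‖U ξ‖ₑ ^ 2 < ⊤)
    (h : ∀ k, ∫⁻ ξ, eweight ξ * ‖u k ξ - U ξ‖ₑ ^ 2 ≤ 2⁻¹ ^ k) {n : ℕ} (hn : n < 4) :
    ∀ᵐ ξ, Tendsto (fun k => convPow (fun η => ‖u k η‖ₑ) volume n ξ) atTop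
      (𝓝 (convPow (fun η => ‖U η‖ₑ) volume n ξ)) := by
  set D : Plane → ℝ≥0∞ := fun ξ => ∑' k, ‖u k ξ - U ξ‖ₑ ^ 2 with hD
  have hDm : Measurable D := by fun_prop
  have hDfin : ∫⁻ ξ, eweight ξ * D ξ < ⊤ := by
    simp_rw [hD, ← ENNReal.tsum_mul_left]
    exact lintegral_tsum_lt_top_of_le_half_pow (fun k => by fun_prop) h
  set W : Plane → ℝ≥0∞ := fun ξ => ‖U ξ‖ₑ + D ξ ^ (1 / 2 : ℝ) with hW
  have hWm : Measurable W := by fun_prop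
  refine tendsto_convPow (W := W) (fun k => (hu k).enorm) hWm ?_ (fun k ξ => ?_) ?_ n hn
  · refine lt_of_le_of_lt (lintegral_mono
      (g := fun ξ => 2 * (eweight ξ * ‖U ξ‖ₑ ^ 2) + 2 * (eweight ξ * D ξ)) fun ξ => ?_) ?_
    · have h1 := ENNReal.rpow_add_le_mul_rpow_add_rpow ‖U ξ‖ₑ (D ξ ^ (1 / 2 : ℝ)) one_le_two
      rw [← ENNReal.rpow_mul] at h1
      norm_num at h1
      calc eweight ξ * W ξ ^ 2 ≤ eweight ξ * (2 * (‖U ξ‖ₑ ^ 2 + D ξ)) := by gcongr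
        _ = _ := by ring
    · rw [lintegral_add_left (by fun_prop), lintegral_const_mul _ (by fun_prop),
        lintegral_const_mul _ (by fun_prop)]
      exact ENNReal.add_lt_top.2 ⟨ENNReal.mul_lt_top (by simp) hfin,
        ENNReal.mul_lt_top (by simp) hDfin⟩
  · have h1 : ‖u k ξ - U ξ‖ₑ ≤ D ξ ^ (1 / 2 : ℝ) := by
      have h2 : ‖u k ξ - U ξ‖ₑ ^ 2 ≤ D ξ := ENNReal.le_tsum (f := fun k => ‖u k ξ - U ξ‖ₑ ^ 2) k
      calc ‖u k ξ - U ξ‖ₑ = (‖u k ξ - U ξ‖ₑ ^ 2) ^ (1 / 2 : ℝ) := by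
            rw [← ENNReal.rpow_natCast, ← ENNReal.rpow_mul]; norm_num
        _ ≤ _ := ENNReal.rpow_le_rpow h2 (by norm_num)
    calc ‖u k ξ‖ₑ = ‖U ξ + (u k ξ - U ξ)‖ₑ := by congr 1; ring
      _ ≤ ‖U ξ‖ₑ + ‖u k ξ - U ξ‖ₑ := enorm_add_le _ _
      _ ≤ _ := add_le_add le_rfl h1
  · have hae : ∀ᵐ ξ, eweight ξ * D ξ < ⊤ := ae_lt_top (by fun_prop) hDfin.ne
    filter_upwards [hae] with ξ hξ
    have : D ξ < ⊤ := lt_of_le_of_lt (le_mul_of_one_le_left zero_le (one_le_eweight ξ)) hξ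
    exact (tendsto_of_tsum_pow_lt_top (m := 1) this).enorm

/-- The Fourier transform of a power of a limit of Schwartz functions. -/
theorem enorm_fourierInv_pow_le {f : ℕ → 𝓢(Plane, ℂ)} {Φ U : Plane → ℂ} (hU : Measurable U)
    (hΦ : AEStronglyMeasurable Φ)
    (hfin : ∫⁻ ξ, eweight ξ * ‖U ξ‖ₑ ^ 2 < ⊤)
    (h2 : ∀ k, ∫⁻ x, ‖f k x - Φ x‖ₑ ^ 2 ≤ 2⁻¹ ^ k)
    (h4 : ∀ k, ∫⁻ x, ‖f k x - Φ x‖ₑ ^ 4 ≤ 2⁻¹ ^ k)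
    (hw : ∀ k, ∫⁻ ξ, eweight ξ * ‖𝓕⁻ (f k) ξ - U ξ‖ₑ ^ 2 ≤ 2⁻¹ ^ k) {p : ℕ} (hp : 1 ≤ p)
    (hp' : p < 4) :
    Integrable (fun x => Φ x ^ (p + 1)) ∧
    ∀ᵐ ξ, ‖𝓕⁻ (fun x => Φ x ^ (p + 1)) ξ‖ₑ ≤ convPow (fun η => ‖U η‖ₑ) volume p ξ := by
  set S : Plane → ℝ≥0∞ := fun x => ∑' k, (‖f k x - Φ x‖ₑ ^ 2 + ‖f k x - Φ x‖ₑ ^ 4) with hS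
  have hem : ∀ k, AEMeasurable (fun x => ‖f k x - Φ x‖ₑ) := fun k =>
    ((f k).continuous.aestronglyMeasurable.sub hΦ).enorm
  have hem' : ∀ k, AEMeasurable (fun x => ‖f k x - Φ x‖ₑ ^ 2 + ‖f k x - Φ x‖ₑ ^ 4) := fun k =>
    ((hem k).pow_const 2).add ((hem k).pow_const 4)
  have hSfin : ∫⁻ x, S x < ⊤ := by
    rw [hS, lintegral_tsum hem']
    have : ∀ k, ∫⁻ x, (‖f k x - Φ x‖ₑ ^ 2 + ‖f k x - Φ x‖ₑ ^ 4) ≤ 2 * 2⁻¹ ^ k := by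
      intro k
      rw [lintegral_add_left' ((hem k).pow_const 2), two_mul]
      exact add_le_add (h2 k) (h4 k)
    refine (ENNReal.tsum_le_tsum this).trans_lt ?_
    rw [ENNReal.tsum_mul_left]
    exact ENNReal.mul_lt_top (by simp) tsum_half_pow_ne_top.lt_top
  have hSm : AEMeasurable S := AEMeasurable.tsum hem'
  have hSae : ∀ᵐ x, S x < ⊤ := ae_lt_top' hSm hSfin.ne
  have hconv : ∀ᵐ x, Tendsto (fun k => f k x) atTop (𝓝 (Φ x)) := by
    filter_upwards [hSae] with x hx
    refine tendsto_of_tsum_pow_lt_top (m := 1) (lt_of_le_of_lt (ENNReal.tsum_le_tsum fun k => ?_) hx)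
    exact le_self_add
  -- One integrable bound for all `k`: `f k = f 0 - (f 0 - Φ) + (f k - Φ)`, both errors are
  -- controlled by `S`, and `t^(p + 1) ≤ t² + t⁴` for `1 ≤ p ≤ 3`. The constant `27` is that of the
  -- fourth power of a sum of three terms.
  set H : Plane → ℝ := fun x => 27 * (2 * (S x).toReal + (‖f 0 x‖ ^ 2 + ‖f 0 x‖ ^ 4)) with hH
  have hHint : Integrable H := by
    refine Integrable.const_mul (((integrable_toReal_of_lintegral_ne_top hSm hSfin.ne).const_mul
      2).add (((f 0).memLp 2 volume).integrable_norm_pow (by norm_num) |>.add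
        (((f 0).memLp 4 volume).integrable_norm_pow (by norm_num)))) _
  have herr : ∀ᵐ x, ∀ k, ‖f k x - Φ x‖ ^ 2 + ‖f k x - Φ x‖ ^ 4 ≤ (S x).toReal := by
    filter_upwards [hSae] with x hx k
    have h1 : ‖f k x - Φ x‖ₑ ^ 2 + ‖f k x - Φ x‖ₑ ^ 4 ≤ S x :=
      ENNReal.le_tsum (f := fun k => ‖f k x - Φ x‖ₑ ^ 2 + ‖f k x - Φ x‖ₑ ^ 4) k
    have h3 := ENNReal.toReal_mono hx.ne h1
    rwa [ENNReal.toReal_add (by simp) (by simp), ENNReal.toReal_pow, ENNReal.toReal_pow,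
      toReal_enorm] at h3
  have hdom : ∀ᵐ x, ∀ k, ‖f k x ^ (p + 1)‖ ≤ H x := by
    filter_upwards [herr] with x hx k
    rw [norm_pow]
    have ht : ‖f k x‖ ≤ ‖f 0 x‖ + ‖f 0 x - Φ x‖ + ‖f k x - Φ x‖ := by
      calc ‖f k x‖ = ‖f 0 x - (f 0 x - Φ x) + (f k x - Φ x)‖ := by congr 1; ring
        _ ≤ ‖f 0 x - (f 0 x - Φ x)‖ + ‖f k x - Φ x‖ := norm_add_le _ _
        _ ≤ _ := by gcongr; exact norm_sub_le _ _
    have e0 := hx 0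
    have ek := hx k
    have hpow : ∀ t : ℝ, 0 ≤ t → t ^ (p + 1) ≤ t ^ 2 + t ^ 4 := by
      intro t ht
      interval_cases p
      · simpa using pow_nonneg ht 4
      · norm_num
        nlinarith [sq_nonneg (t * (t - 1)), sq_nonneg t, pow_nonneg ht 4]
      · simpa using pow_nonneg ht 2
    set a := ‖f 0 x‖
    set b := ‖f 0 x - Φ x‖
    set c := ‖f k x - Φ x‖
    have ha : 0 ≤ a := norm_nonneg _
    have hb : 0 ≤ b := norm_nonneg _
    have hc : 0 ≤ c := norm_nonneg _
    have q2 : ∀ a b c : ℝ, (a + b + c) ^ 2 ≤ 3 * (a ^ 2 + b ^ 2 + c ^ 2) := fun a b c => by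
      nlinarith [sq_nonneg (a - b), sq_nonneg (a - c), sq_nonneg (b - c)]
    have q4 : (a + b + c) ^ 4 ≤ 27 * (a ^ 4 + b ^ 4 + c ^ 4) := by
      calc (a + b + c) ^ 4 = ((a + b + c) ^ 2) ^ 2 := by ring
        _ ≤ (3 * (a ^ 2 + b ^ 2 + c ^ 2)) ^ 2 := by gcongr; exact q2 a b c
        _ = 9 * (a ^ 2 + b ^ 2 + c ^ 2) ^ 2 := by ring
        _ ≤ 9 * (3 * ((a ^ 2) ^ 2 + (b ^ 2) ^ 2 + (c ^ 2) ^ 2)) := by gcongr; exact q2 _ _ _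
        _ = _ := by ring
    calc ‖f k x‖ ^ (p + 1) ≤ (a + b + c) ^ (p + 1) := by gcongr
      _ ≤ (a + b + c) ^ 2 + (a + b + c) ^ 4 := hpow _ (by positivity)
      _ ≤ 3 * (a ^ 2 + b ^ 2 + c ^ 2) + 27 * (a ^ 4 + b ^ 4 + c ^ 4) := add_le_add (q2 _ _ _) q4
      _ ≤ H x := by
        simp only [hH]
        nlinarith [sq_nonneg a, sq_nonneg b, sq_nonneg c]
  have hlimpow : ∀ᵐ x, Tendsto (fun k => f k x ^ (p + 1)) atTop (𝓝 (Φ x ^ (p + 1))) := by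
    filter_upwards [hconv] with x hx
    exact hx.pow _
  have hint : Integrable (fun x => Φ x ^ (p + 1)) := by
    refine hHint.mono' (hΦ.pow _) ?_
    filter_upwards [hlimpow, hdom] with x h1 h2
    exact le_of_tendsto' h1.norm h2
  refine ⟨hint, ?_⟩
  have hleft : ∀ ξ, Tendsto (fun k => 𝓕⁻ (schwartzPow (f k) p) ξ) atTop
      (𝓝 (𝓕⁻ (fun x => Φ x ^ (p + 1)) ξ)) := by
    intro ξ
    simp_rw [SchwartzMap.fourierInv_coe, Real.fourierInv_eq, schwartzPow_apply]
    refine tendsto_integral_of_dominated_convergence H (fun k => ?_) hHint (fun k => ?_) ?_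
    · have : Continuous (fun v : Plane => Real.fourierChar (inner ℝ v ξ) • f k v ^ (p + 1)) :=
        (Real.continuous_fourierChar.comp (by fun_prop)).smul ((f k).continuous.pow _)
      exact this.aestronglyMeasurable
    · filter_upwards [hdom] with x hx
      simpa using hx k
    · filter_upwards [hlimpow] with x hx
      exact hx.const_smul _
  filter_upwards [tendsto_convPow_of_weighted (u := fun k => ⇑(𝓕⁻ (f k) : 𝓢(Plane, ℂ)))
    (fun k => (𝓕⁻ (f k)).continuous.measurable) hU hfin hw hp'] with ξ hξ
  exact le_of_tendsto_of_tendsto' (hleft ξ).enorm hξ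
    fun k => enorm_fourierInv_schwartzPow_le (f k) p ξ

/-! ### The Hilbert transform of a derivative as an integral of second differences. -/

section SecondDifference

variable {g : ℝ → ℝ}

/-- The quadratic bound serves near `t = 0` and comes from the Lipschitz constant of `g'`; the
constant bound serves at infinity and comes from boundedness of `g`. -/
theorem abs_secondDiff_le (hg : ContDiff ℝ 2 g) (hc : HasCompactSupport g) (x : ℝ) :
    ∃ C : ℝ, 0 ≤ C ∧ ∀ t : ℝ, 0 ≤ t → |2 * g x - g (x + t) - g (x - t)| ≤ C * t ^ 2 ∧
      |2 * g x - g (x + t) - g (x - t)| ≤ C := by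
  have hd : ∀ y, HasDerivAt g (deriv g y) y := fun y =>
    (hg.differentiable (by norm_num) y).hasDerivAt
  have hg1 : ContDiff ℝ 1 (deriv g) := by
    have : ContDiff ℝ (1 + 1) g := hg
    exact (contDiff_succ_iff_deriv.1 this).2.2
  obtain ⟨L, hL⟩ := hg1.lipschitzWith_of_hasCompactSupport hc.deriv (by norm_num)
  obtain ⟨M, hM⟩ := hc.exists_bound_of_continuous hg.continuous
  have hM0 : 0 ≤ M := (norm_nonneg _).trans (hM 0)
  refine ⟨2 * L + 4 * M, by positivity, fun t ht => ⟨?_, ?_⟩⟩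
  · have key := norm_image_sub_le_of_norm_deriv_le_segment' (a := 0) (b := t) (C := 2 * L * t)
      (f := fun s => 2 * g x - g (x + s) - g (x - s))
      (f' := fun s => deriv g (x - s) - deriv g (x + s)) (fun s _ => by
        have h1 : HasDerivAt (fun s => g (x + s)) (deriv g (x + s)) s :=
          HasDerivAt.comp_const_add x s (hd _)
        have h2 : HasDerivAt (fun s => g (x - s)) (-deriv g (x - s)) s :=
          HasDerivAt.comp_const_sub x s (hd _)
        have h3 := (h1.const_sub (2 * g x)).sub h2
        exact (h3.congr_deriv (by ring)).hasDerivWithinAt)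
      (fun s hs => by
        have h := hL.dist_le_mul (x - s) (x + s)
        rw [Real.dist_eq, Real.dist_eq] at h
        have e : |x - s - (x + s)| = 2 * s := by
          rw [show x - s - (x + s) = -(2 * s) by ring, abs_neg, abs_of_nonneg (by linarith [hs.1])]
        rw [e] at h
        have : (L : ℝ) * (2 * s) ≤ 2 * L * t := by
          have := mul_le_mul_of_nonneg_left hs.2.le L.2
          have e2 : (L : ℝ) * (2 * s) = 2 * (L * s) := by ring
          rw [e2, mul_assoc]
          exact mul_le_mul_of_nonneg_left this two_pos.le
        exact h.trans this) t ⟨ht, le_rfl⟩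
    have e0 : 2 * g x - g (x + 0) - g (x - 0) = 0 := by simp; ring
    simp only [Real.norm_eq_abs] at key
    rw [e0, sub_zero] at key
    nlinarith [mul_nonneg hM0 (sq_nonneg t)]
  · have h1 := hM x
    have h2 := hM (x + t)
    have h3 := hM (x - t)
    simp only [Real.norm_eq_abs, abs_le] at h1 h2 h3
    have := L.2
    rw [abs_le]
    constructor <;> linarith

theorem continuous_secondDiff (hg : Continuous g) (x : ℝ) :
    Continuous fun t => 2 * g x - g (x + t) - g (x - t) := by fun_prop

theorem integrableOn_secondDiff_div_sq (hg : ContDiff ℝ 2 g) (hc : HasCompactSupport g) (x : ℝ) :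
    IntegrableOn (fun t => (2 * g x - g (x + t) - g (x - t)) / t ^ 2) (Set.Ioi 0) := by
  obtain ⟨C, hC0, hC⟩ := abs_secondDiff_le hg hc x
  have hi : IntegrableOn (fun t : ℝ => 2 * C * (1 + t ^ 2)⁻¹) (Set.Ioi 0) :=
    (integrable_inv_one_add_sq.const_mul _).integrableOn
  refine Integrable.mono' hi ?_ ?_
  · exact ((continuous_secondDiff hg.continuous x).measurable.div
      (measurable_id.pow_const 2)).aestronglyMeasurable
  · filter_upwards [ae_restrict_mem measurableSet_Ioi] with t ht
    have ht : 0 < t := ht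
    obtain ⟨h1, h2⟩ := hC t ht.le
    rw [Real.norm_eq_abs, abs_div, abs_of_pos (by positivity : 0 < t ^ 2), ← div_eq_mul_inv,
      div_le_div_iff₀ (by positivity) (by positivity)]
    nlinarith [mul_le_mul_of_nonneg_right h2 (sq_nonneg t)]

/-- Folding `t` with `-t` turns the integrand into `D'(t) / t`, where `D` is the second difference;
integration by parts then leaves the boundary term `-D(δ) / δ` and the integral of `D(t) / t²`. -/
theorem truncated_hilbert_eq (hg : ContDiff ℝ 2 g) (hc : HasCompactSupport g) (x : ℝ) {δ : ℝ}
    (hδ : 0 < δ) :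
    ∫ z in {z : ℝ | δ < |x - z|}, deriv g z / (x - z) =
      -((2 * g x - g (x + δ) - g (x - δ)) / δ) +
        ∫ t in Set.Ioi δ, (2 * g x - g (x + t) - g (x - t)) / t ^ 2 := by
  have hd : ∀ y, HasDerivAt g (deriv g y) y := fun y =>
    (hg.differentiable (by norm_num) y).hasDerivAt
  have hgc : Continuous (deriv g) := hg.continuous_deriv (by norm_num)
  have hgi : Integrable (deriv g) := hgc.integrable_of_hasCompactSupport hc.deriv
  set h : ℝ → ℝ := fun t => deriv g (x - t) / t with hh
  have hset : {t : ℝ | δ < |t|} = Set.Iio (-δ) ∪ Set.Ioi δ := by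
    ext t
    simp only [Set.mem_ofPred_eq, lt_abs, Set.mem_union, Set.mem_Iio, Set.mem_Ioi]
    constructor
    · rintro (h | h)
      · exact Or.inr h
      · exact Or.inl (by linarith)
    · rintro (h | h)
      · exact Or.inr (by linarith)
      · exact Or.inl h
  have hmeas : MeasurableSet {t : ℝ | δ < |t|} := measurableSet_lt measurable_const (by fun_prop)
  have hint : IntegrableOn h {t : ℝ | δ < |t|} := by
    refine Integrable.mono' (((hgi.comp_sub_left x).norm.const_mul δ⁻¹).integrableOn)
      (((hgc.comp (by fun_prop)).measurable.div measurable_id).aestronglyMeasurable) ?_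
    filter_upwards [ae_restrict_mem hmeas] with t ht
    have ht : δ < |t| := ht
    rw [hh, norm_div, div_eq_inv_mul, Real.norm_eq_abs t]
    gcongr
  have e1 : ∫ z in {z : ℝ | δ < |x - z|}, deriv g z / (x - z) = ∫ t in {t : ℝ | δ < |t|}, h t := by
    rw [← integral_indicator hmeas, ← integral_indicator
      (measurableSet_lt measurable_const (by fun_prop)),
      ← integral_sub_left_eq_self (Set.indicator {t : ℝ | δ < |t|} h) volume x]
    refine integral_congr_ae (Eventually.of_forall fun z => ?_)
    simp only [Set.indicator, Set.mem_ofPred_eq, hh, sub_sub_cancel]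
  have hintI : IntegrableOn h (Set.Iio (-δ)) := hint.mono_set (by rw [hset]; exact Set.subset_union_left)
  have hintJ : IntegrableOn h (Set.Ioi δ) := hint.mono_set (by rw [hset]; exact Set.subset_union_right)
  have hintK : IntegrableOn (fun t => h (-t)) (Set.Ioi δ) := by
    have h1 := (integrable_indicator_iff measurableSet_Iio).2 hintI
    have h2 := h1.comp_neg
    refine (integrable_indicator_iff measurableSet_Ioi).1 (h2.congr (Eventually.of_forall fun t => ?_))
    simp only [Set.indicator, Set.mem_Iio, Set.mem_Ioi, neg_lt_neg_iff]
  have e2 : ∫ t in {t : ℝ | δ < |t|}, h t = ∫ t in Set.Ioi δ, (h t + h (-t)) := by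
    rw [hset, setIntegral_union (by
        rw [Set.disjoint_left]
        intro t h1 h2
        simp only [Set.mem_Iio, Set.mem_Ioi] at h1 h2
        linarith) measurableSet_Ioi hintI hintJ,
      integral_add hintJ hintK, add_comm]
    congr 1
    rw [← integral_Iic_eq_integral_Iio, ← integral_comp_neg_Ioi]
  have hD2 : IntegrableOn (fun t => (2 * g x - g (x + t) - g (x - t)) / t ^ 2) (Set.Ioi δ) :=
    (integrableOn_secondDiff_div_sq hg hc x).mono_set (Set.Ioi_subset_Ioi hδ.le)
  have hderiv : ∀ t ∈ Set.Ici δ, HasDerivAt (fun t => (2 * g x - g (x + t) - g (x - t)) / t)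
      ((h t + h (-t)) - (2 * g x - g (x + t) - g (x - t)) / t ^ 2) t := by
    intro t ht
    have ht0 : t ≠ 0 := (hδ.trans_le ht).ne'
    have h1 : HasDerivAt (fun s => g (x + s)) (deriv g (x + t)) t :=
      HasDerivAt.comp_const_add x t (hd _)
    have h2 : HasDerivAt (fun s => g (x - s)) (-deriv g (x - t)) t :=
      HasDerivAt.comp_const_sub x t (hd _)
    have h3 := ((h1.const_sub (2 * g x)).sub h2).div (hasDerivAt_id t) ht0
    refine h3.congr_deriv ?_
    simp only [hh, id, sub_neg_eq_add, Pi.sub_apply]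
    field_simp
    ring
  have hsum : IntegrableOn (fun t => h t + h (-t)) (Set.Ioi δ) :=
    hintJ.add hintK
  have hlim : Tendsto (fun t => (2 * g x - g (x + t) - g (x - t)) / t) atTop (𝓝 0) := by
    obtain ⟨C, hC0, hC⟩ := abs_secondDiff_le hg hc x
    refine squeeze_zero_norm' (a := fun t => C / t) ?_ (tendsto_const_nhds.div_atTop tendsto_id)
    filter_upwards [eventually_gt_atTop 0] with t ht
    rw [norm_div, Real.norm_eq_abs, Real.norm_of_nonneg ht.le]
    gcongr
    exact (hC t ht.le).2
  have := integral_Ioi_of_hasDerivAt_of_tendsto' hderiv (hsum.sub hD2) hlim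
  rw [integral_sub hsum hD2] at this
  rw [e1, e2]
  linarith

/-- The boundary term is `O(δ)` because `D(δ) = O(δ²)`, and the remaining integral converges
absolutely down to `0`. -/
theorem tendsto_truncated_hilbert (hg : ContDiff ℝ 2 g) (hc : HasCompactSupport g) (x : ℝ) :
    Tendsto (fun δ => ∫ z in {z : ℝ | δ < |x - z|}, deriv g z / (x - z)) (𝓝[>] 0)
      (𝓝 (∫ t in Set.Ioi 0, (2 * g x - g (x + t) - g (x - t)) / t ^ 2)) := by
  have h1 : Tendsto (fun δ => -((2 * g x - g (x + δ) - g (x - δ)) / δ)) (𝓝[>] 0) (𝓝 0) := by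
    obtain ⟨C, hC0, hC⟩ := abs_secondDiff_le hg hc x
    refine squeeze_zero_norm' (a := fun t => C * t) ?_ ?_
    · filter_upwards [self_mem_nhdsWithin] with t ht
      have ht : 0 < t := ht
      rw [norm_neg, norm_div, Real.norm_eq_abs, Real.norm_of_nonneg ht.le, div_le_iff₀ ht]
      linarith [(hC t ht.le).1]
    · have : Tendsto (fun t : ℝ => C * t) (𝓝 0) (𝓝 (C * 0)) := tendsto_id.const_mul C
      rw [mul_zero] at this
      exact this.mono_left nhdsWithin_le_nhds
  have h2 : Tendsto (fun δ => ∫ t in Set.Ioi δ, (2 * g x - g (x + t) - g (x - t)) / t ^ 2)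
      (𝓝[>] 0) (𝓝 (∫ t in Set.Ioi 0, (2 * g x - g (x + t) - g (x - t)) / t ^ 2)) := by
    have hi := integrableOn_secondDiff_div_sq hg hc x
    simp_rw [← integral_indicator measurableSet_Ioi]
    refine tendsto_integral_filter_of_dominated_convergence
      (fun t => ‖(Set.Ioi 0).indicator
        (fun t => (2 * g x - g (x + t) - g (x - t)) / t ^ 2) t‖) ?_ ?_
      ((integrable_indicator_iff measurableSet_Ioi).2 hi).norm ?_
    · filter_upwards [self_mem_nhdsWithin] with δ hδ
      exact ((integrable_indicator_iff measurableSet_Ioi).2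
        (hi.mono_set (Set.Ioi_subset_Ioi (le_of_lt hδ)))).aestronglyMeasurable
    · filter_upwards [self_mem_nhdsWithin] with δ hδ
      refine Eventually.of_forall fun t => ?_
      exact norm_indicator_le_of_subset (Set.Ioi_subset_Ioi (le_of_lt hδ)) _ _
    · refine Eventually.of_forall fun t => ?_
      refine tendsto_const_nhds.congr' ?_
      by_cases ht : 0 < t
      · filter_upwards [nhdsWithin_le_nhds (Iio_mem_nhds ht)] with δ hδ
        rw [Set.indicator_of_mem (show t ∈ Set.Ioi 0 from ht),
          Set.indicator_of_mem (show t ∈ Set.Ioi δ from hδ)]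
      · filter_upwards [self_mem_nhdsWithin] with δ hδ
        have hδ : 0 < δ := hδ
        rw [Set.indicator_of_notMem (show t ∉ Set.Ioi 0 from ht),
          Set.indicator_of_notMem (show t ∉ Set.Ioi δ from fun h => ht (hδ.trans h))]
  have h3 := h1.add h2
  rw [zero_add] at h3
  refine h3.congr' ?_
  filter_upwards [self_mem_nhdsWithin] with δ hδ
  exact (truncated_hilbert_eq hg hc x hδ).symm

end SecondDifference

/-! ### The multiplier produced by second differences. -/

section Kernel

theorem two_sub_cos_div_sq_le (a t : ℝ) :
    (2 - 2 * Real.cos (a * t)) / t ^ 2 ≤ (4 + a ^ 2) * (1 + t ^ 2)⁻¹ := by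
  rcases eq_or_ne t 0 with rfl | ht
  · simp; positivity
  have h1 : 2 - 2 * Real.cos (a * t) ≤ (a * t) ^ 2 := by
    linarith [Real.one_sub_sq_div_two_le_cos (x := a * t)]
  have h2 : 2 - 2 * Real.cos (a * t) ≤ 4 := by linarith [Real.neg_one_le_cos (a * t)]
  rw [← div_eq_mul_inv, div_le_div_iff₀ (by positivity) (by positivity)]
  nlinarith [mul_le_mul_of_nonneg_right h2 (sq_nonneg t)]

theorem two_sub_cos_div_sq_nonneg (a t : ℝ) : 0 ≤ (2 - 2 * Real.cos (a * t)) / t ^ 2 :=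
  div_nonneg (by linarith [Real.cos_le_one (a * t)]) (sq_nonneg t)

theorem integrable_two_sub_cos_div_sq (a : ℝ) :
    Integrable fun t : ℝ => (2 - 2 * Real.cos (a * t)) / t ^ 2 := by
  refine (integrable_inv_one_add_sq.const_mul (4 + a ^ 2)).mono' ?_ (Eventually.of_forall fun t => ?_)
  · exact Measurable.aestronglyMeasurable (by fun_prop)
  · rw [Real.norm_of_nonneg (two_sub_cos_div_sq_nonneg a t)]
    exact two_sub_cos_div_sq_le a t

/-- The constant `∫₀^∞ (2 - 2 cos t) / t² dt`. -/
def cosConst : ℝ := ∫ t in Set.Ioi (0 : ℝ), (2 - 2 * Real.cos t) / t ^ 2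

/-- Ellipticity of the symbol needs only the sign of this constant, not its value. -/
theorem cosConst_pos : 0 < cosConst := by
  unfold cosConst
  have hi : IntegrableOn (fun t : ℝ => (2 - 2 * Real.cos t) / t ^ 2) (Set.Ioi 0) := by
    simpa using (integrable_two_sub_cos_div_sq 1).integrableOn
  have hnn : ∀ t : ℝ, 0 ≤ (2 - 2 * Real.cos t) / t ^ 2 := fun t => by
    simpa using two_sub_cos_div_sq_nonneg 1 t
  rw [setIntegral_pos_iff_support_of_nonneg_ae (Eventually.of_forall hnn) hi]
  refine lt_of_lt_of_le ?_ (measure_mono (s := Set.Ioo (0 : ℝ) 1) ?_)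
  · simp
  · intro t ht
    refine ⟨?_, ht.1⟩
    have : Real.cos t < 1 := by
      rw [← Real.cos_zero]
      exact Real.cos_lt_cos_of_nonneg_of_le_pi_div_two le_rfl
        (by linarith [ht.2, Real.pi_gt_three]) ht.1
    have : 0 < (2 - 2 * Real.cos t) / t ^ 2 := div_pos (by linarith) (pow_pos ht.1 2)
    exact this.ne'

theorem integral_two_sub_cos_div_sq (a : ℝ) :
    ∫ t in Set.Ioi (0 : ℝ), (2 - 2 * Real.cos (a * t)) / t ^ 2 = |a| * cosConst := by
  rcases eq_or_ne a 0 with rfl | ha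
  · simp
  have ha' : 0 < |a| := abs_pos.2 ha
  have h := integral_comp_mul_left_Ioi (fun t : ℝ => (2 - 2 * Real.cos t) / t ^ 2) 0 ha'
  rw [mul_zero, smul_eq_mul] at h
  have e : ∀ t : ℝ, (2 - 2 * Real.cos (a * t)) / t ^ 2 =
      |a| ^ 2 * ((2 - 2 * Real.cos (|a| * t)) / (|a| * t) ^ 2) := by
    intro t
    have : Real.cos (|a| * t) = Real.cos (a * t) := by
      rcases abs_choice a with h | h <;> rw [h]
      rw [neg_mul, Real.cos_neg]
    rw [this]
    rcases eq_or_ne t 0 with rfl | ht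
    · simp
    · field_simp
  simp_rw [e]
  rw [integral_const_mul, h, cosConst]
  field_simp

end Kernel

/-! ### The Hilbert transform term as a Fourier multiplier on test functions. -/

theorem IsTest.slice {ψ : ℝ × ℝ → ℝ} (h : IsTest ψ) (y : ℝ) :
    ContDiff ℝ 2 (fun s => ψ (s, y)) ∧ HasCompactSupport (fun s => ψ (s, y)) := by
  refine ⟨(contDiff_infty.1 h.1 2).comp (contDiff_id.prodMk contDiff_const), ?_⟩
  refine HasCompactSupport.intro (K := Prod.fst '' tsupport ψ)
    (h.2.isCompact.image continuous_fst) fun s hs => ?_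
  refine image_eq_zero_of_notMem_tsupport fun hmem => hs ⟨(s, y), hmem, rfl⟩

theorem IsTest.hilbertX_partialX {ψ : ℝ × ℝ → ℝ} (h : IsTest ψ) (w : ℝ × ℝ) :
    hilbertX (partialX ψ) w = (1 / Real.pi) *
      ∫ t in Set.Ioi 0, (2 * ψ w - ψ (w.1 + t, w.2) - ψ (w.1 - t, w.2)) / t ^ 2 := by
  obtain ⟨h1, h2⟩ := h.slice w.2
  exact ((tendsto_truncated_hilbert h1 h2 w.1).const_mul (1 / Real.pi)).limUnder_eq

theorem schwartz_integrable_weight (F : 𝓢(Plane, ℂ)) :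
    Integrable (fun ξ : Plane => (1 + ‖ξ‖ ^ 2) * ‖F ξ‖) := by
  have h1 := F.integrable_pow_mul volume 2
  have h0 := F.integrable (μ := volume).norm
  refine (h0.add h1).congr (Eventually.of_forall fun ξ => ?_)
  simp only [Pi.add_apply]
  ring

theorem abs_fst_le_norm (ξ : Plane) : |ξ.fst| ≤ ‖ξ‖ := WithLp.norm_fst_le _ ξ

theorem abs_snd_le_norm (ξ : Plane) : |ξ.snd| ≤ ‖ξ‖ := WithLp.norm_snd_le _ ξ

theorem schwartz_bddAbove_weight (F : 𝓢(Plane, ℂ)) :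
    ∃ C : ℝ, ∀ ξ : Plane, (1 + ‖ξ‖ ^ 2) * ‖F ξ‖ ≤ C := by
  obtain ⟨C0, hC0⟩ := F.decay 0 0
  obtain ⟨C2, hC2⟩ := F.decay 2 0
  refine ⟨C0 + C2, fun ξ => ?_⟩
  have h0 := hC0.2 ξ
  have h2 := hC2.2 ξ
  simp only [pow_zero, one_mul, norm_iteratedFDeriv_zero] at h0 h2
  linarith

/-- Symbols of quadratic growth map Schwartz functions to `L¹ ∩ L²`. -/
theorem symbol_mul_schwartz {m : Plane → ℂ} (hm : Continuous m) {C : ℝ}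
    (hC : ∀ ξ, ‖m ξ‖ ≤ C * (1 + ‖ξ‖ ^ 2)) (F : 𝓢(Plane, ℂ)) :
    Integrable (fun ξ => m ξ * F ξ) ∧ MemLp (fun ξ => m ξ * F ξ) 2 volume := by
  have hmeas : AEStronglyMeasurable (fun ξ => m ξ * F ξ) :=
    (hm.mul F.continuous).aestronglyMeasurable
  have hle : ∀ ξ, ‖m ξ * F ξ‖ ≤ C * ((1 + ‖ξ‖ ^ 2) * ‖F ξ‖) := fun ξ => by
    rw [norm_mul, ← mul_assoc]
    gcongr
    exact hC ξ
  have hint : Integrable (fun ξ => m ξ * F ξ) :=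
    ((schwartz_integrable_weight F).const_mul C).mono' hmeas (Eventually.of_forall hle)
  refine ⟨hint, ?_⟩
  obtain ⟨B, hB⟩ := schwartz_bddAbove_weight F
  have hC0 : 0 ≤ C := by
    have := (norm_nonneg _).trans (hC 0)
    simpa using this
  have hbd : ∀ ξ, ‖m ξ * F ξ‖ ≤ C * B := fun ξ =>
    (hle ξ).trans (mul_le_mul_of_nonneg_left (hB ξ) hC0)
  rw [memLp_two_iff_integrable_sq_norm hmeas]
  refine (hint.norm.const_mul (C * B)).mono' (hmeas.norm.pow 2) (Eventually.of_forall fun ξ => ?_)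
  rw [Real.norm_of_nonneg (by positivity), pow_two]
  exact mul_le_mul_of_nonneg_right (hbd ξ) (norm_nonneg _)

theorem IsTest.toSchwartz_eq_integral {ψ : ℝ × ℝ → ℝ} (h : IsTest ψ) (v : Plane) :
    (ψ v.ofLp : ℂ) = ∫ ξ : Plane,
      Complex.exp (↑(2 * Real.pi * inner ℝ ξ v) * Complex.I) * 𝓕 h.toSchwartz ξ := by
  have h1 : (ψ v.ofLp : ℂ) = 𝓕⁻ (𝓕 h.toSchwartz) v := by
    rw [FourierTransform.fourierInv_fourier_eq, h.toSchwartz_apply]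
  rw [h1, SchwartzMap.fourierInv_coe, Real.fourierInv_eq']
  simp only [smul_eq_mul]

theorem integrable_exp_mul_schwartz (F : 𝓢(Plane, ℂ)) (v : Plane) :
    Integrable fun ξ : Plane => Complex.exp (↑(2 * Real.pi * inner ℝ ξ v) * Complex.I) * F ξ := by
  refine (F.integrable (μ := volume)).norm.mono' ?_ (Eventually.of_forall fun ξ => ?_)
  · exact Continuous.aestronglyMeasurable (by have := F.continuous; fun_prop)
  · rw [norm_mul, Complex.norm_exp_ofReal_mul_I, one_mul]

theorem IsTest.secondDiff_eq_integral {ψ : ℝ × ℝ → ℝ} (h : IsTest ψ) (v : Plane) (t : ℝ) :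
    ((2 * ψ v.ofLp - ψ (v.fst + t, v.snd) - ψ (v.fst - t, v.snd) : ℝ) : ℂ) = ∫ ξ : Plane,
      (Complex.exp (↑(2 * Real.pi * inner ℝ ξ v) * Complex.I) * 𝓕 h.toSchwartz ξ) *
        ((2 - 2 * Real.cos (2 * Real.pi * ξ.fst * t) : ℝ) : ℂ) := by
  obtain ⟨F, hF⟩ : ∃ F, F = 𝓕 h.toSchwartz := ⟨_, rfl⟩
  have e0 := h.toSchwartz_eq_integral v
  have e1 := h.toSchwartz_eq_integral (WithLp.toLp 2 (v.fst + t, v.snd))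
  have e2 := h.toSchwartz_eq_integral (WithLp.toLp 2 (v.fst - t, v.snd))
  simp only [← hF] at e0 e1 e2 ⊢
  push_cast
  rw [e0, e1, e2, ← integral_const_mul, ← integral_sub, ← integral_sub]
  · congr 1
    ext ξ
    have i1 : inner ℝ ξ (WithLp.toLp 2 (v.fst + t, v.snd) : Plane) = inner ℝ ξ v + t * ξ.fst := by
      simp [WithLp.prod_inner_apply]; ring
    have i2 : inner ℝ ξ (WithLp.toLp 2 (v.fst - t, v.snd) : Plane) = inner ℝ ξ v - t * ξ.fst := by
      simp [WithLp.prod_inner_apply]; ring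
    rw [i1, i2, Complex.cos]
    have x1 : Complex.exp (↑(2 * Real.pi * (inner ℝ ξ v + t * ξ.fst)) * Complex.I) =
        Complex.exp (↑(2 * Real.pi * inner ℝ ξ v) * Complex.I) *
          Complex.exp (2 * Real.pi * ξ.fst * t * Complex.I) := by
      rw [← Complex.exp_add]; congr 1; push_cast; ring
    have x2 : Complex.exp (↑(2 * Real.pi * (inner ℝ ξ v - t * ξ.fst)) * Complex.I) =
        Complex.exp (↑(2 * Real.pi * inner ℝ ξ v) * Complex.I) *
          Complex.exp (-(2 * Real.pi * ξ.fst * t) * Complex.I) := by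
      rw [← Complex.exp_add]; congr 1; push_cast; ring
    rw [x1, x2]
    push_cast
    ring
  · exact ((integrable_exp_mul_schwartz F v).const_mul 2).sub (integrable_exp_mul_schwartz F _)
  · exact integrable_exp_mul_schwartz F _
  · exact (integrable_exp_mul_schwartz F v).const_mul 2
  · exact integrable_exp_mul_schwartz F _

/-- A second difference in `x` multiplies the Fourier transform by `2 - 2 cos(2π ξ₁ t)`. Fubini
allows integrating this against `dt / t²` first, which gives `2π |ξ₁| cosConst`; the prefactor `1/π`
cancels the `π`. -/
theorem IsTest.hilbertX_eq_fourierInv {ψ : ℝ × ℝ → ℝ} (h : IsTest ψ) (v : Plane) :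
    (hilbertX (partialX ψ) v.ofLp : ℂ) =
      𝓕⁻ (fun ξ : Plane => ((2 * cosConst * |ξ.fst| : ℝ) : ℂ) * 𝓕 h.toSchwartz ξ) v := by
  set F := 𝓕 h.toSchwartz with hF
  set A : Plane → ℂ := fun ξ => Complex.exp (↑(2 * Real.pi * inner ℝ ξ v) * Complex.I) * F ξ with hA
  have hAc : Continuous A := by have := F.continuous; fun_prop
  have hAn : ∀ ξ, ‖A ξ‖ = ‖F ξ‖ := fun ξ => by
    rw [hA, norm_mul, Complex.norm_exp_ofReal_mul_I, one_mul]
  set k : ℝ → Plane → ℝ := fun t ξ => (2 - 2 * Real.cos (2 * Real.pi * ξ.fst * t)) / t ^ 2 with hk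
  -- The kernel is at most `(4 + (2π ξ₁)²) / (1 + t²)`, a product bound whose growth in `ξ` the
  -- Schwartz function absorbs.
  have hint : Integrable (Function.uncurry fun t ξ => A ξ * (k t ξ : ℂ))
      ((volume.restrict (Set.Ioi 0)).prod volume) := by
    have hb : Integrable (fun ξ : Plane => (4 + (2 * Real.pi * ξ.fst) ^ 2) * ‖F ξ‖) := by
      refine ((schwartz_integrable_weight F).const_mul (4 + (2 * Real.pi) ^ 2)).mono'
        (Continuous.aestronglyMeasurable (by have := F.continuous; fun_prop))
        (Eventually.of_forall fun ξ => ?_)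
      rw [Real.norm_of_nonneg (by positivity), ← mul_assoc]
      gcongr
      have h1 : ξ.fst ^ 2 ≤ ‖ξ‖ ^ 2 := by
        rw [← sq_abs]; gcongr; exact abs_fst_le_norm ξ
      nlinarith [mul_le_mul_of_nonneg_left h1 (sq_nonneg (2 * Real.pi)), sq_nonneg ‖ξ‖,
        sq_nonneg (2 * Real.pi)]
    have hp := (integrable_inv_one_add_sq.restrict (s := Set.Ioi (0 : ℝ))).mul_prod hb
    refine hp.mono' ?_ (Eventually.of_forall fun z => ?_)
    · refine Measurable.aestronglyMeasurable ?_
      have := hAc.measurable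
      simp only [Function.uncurry_def, hk]
      fun_prop
    · simp only [Function.uncurry]
      rw [norm_mul, hAn, Complex.norm_real, Real.norm_of_nonneg (two_sub_cos_div_sq_nonneg _ _)]
      calc ‖F z.2‖ * k z.1 z.2 ≤ ‖F z.2‖ * ((4 + (2 * Real.pi * z.2.fst) ^ 2) * (1 + z.1 ^ 2)⁻¹) := by
            gcongr
            exact two_sub_cos_div_sq_le _ _
        _ = _ := by ring
  have hpt : ∀ t : ℝ, (((2 * ψ v.ofLp - ψ (v.fst + t, v.snd) - ψ (v.fst - t, v.snd)) / t ^ 2 : ℝ) : ℂ)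
      = ∫ ξ, A ξ * (k t ξ : ℂ) := by
    intro t
    rw [Complex.ofReal_div, h.secondDiff_eq_integral v t, ← integral_div]
    congr 1
    ext ξ
    simp only [hA, hk, Complex.ofReal_div]
    ring
  rw [h.hilbertX_partialX, Complex.ofReal_mul, ← integral_complex_ofReal]
  have e : ∀ t : ℝ, (((2 * ψ v.ofLp - ψ (v.ofLp.1 + t, v.ofLp.2) - ψ (v.ofLp.1 - t, v.ofLp.2)) /
      t ^ 2 : ℝ) : ℂ) = ∫ ξ, A ξ * (k t ξ : ℂ) := hpt
  simp_rw [e]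
  rw [integral_integral_swap hint, Real.fourierInv_eq', ← integral_const_mul]
  congr 1
  ext ξ
  rw [integral_const_mul, integral_complex_ofReal, integral_two_sub_cos_div_sq, smul_eq_mul, hA]
  simp only [abs_mul, abs_of_pos Real.pi_pos, Nat.abs_ofNat]
  push_cast
  have := Real.pi_ne_zero
  field_simp

/-! ### Multiplication formulas, uniqueness and Plancherel for integrable functions. -/

section FourierFormulas

variable {E : Type*} [NormedAddCommGroup E] [InnerProductSpace ℝ E] [FiniteDimensional ℝ E]
  [MeasurableSpace E] [BorelSpace E]

/-- The multiplication formula for the inverse Fourier transform. -/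
theorem integral_fourierInv_mul {f g : E → ℂ} (hf : Integrable f) (hg : Integrable g) :
    ∫ ξ, 𝓕⁻ f ξ * g ξ = ∫ x, f x * 𝓕⁻ g x := by
  have h := VectorFourier.integral_bilin_fourierIntegral_eq_flip (ContinuousLinearMap.mul ℂ ℂ)
    (L := -innerₗ E) (μ := volume) (ν := volume) Real.continuous_fourierChar
    (continuous_inner (𝕜 := ℝ) (E := E)).neg hf hg
  have e : ∀ f : E → ℂ, 𝓕⁻ f = VectorFourier.fourierIntegral Real.fourierChar volume
      (-innerₗ E) f := by
    intro f; ext ξ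
    simp [Real.fourierInv_eq, VectorFourier.fourierIntegral]
  have e' : (-innerₗ E).flip = -innerₗ E := by
    ext x y; simp [real_inner_comm]
  rw [e' ] at h
  simpa [e] using h

/-- The multiplication formula for the Fourier transform. -/
theorem integral_fourier_mul {f g : E → ℂ} (hf : Integrable f) (hg : Integrable g) :
    ∫ ξ, 𝓕 f ξ * g ξ = ∫ x, f x * 𝓕 g x := by
  have h := VectorFourier.integral_bilin_fourierIntegral_eq_flip (ContinuousLinearMap.mul ℂ ℂ)
    (L := innerₗ E) (μ := volume) (ν := volume) Real.continuous_fourierChar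
    (by simpa using continuous_inner) hf hg
  simpa using! h

theorem continuous_fourierInv {f : E → ℂ} (hf : Integrable f) : Continuous (𝓕⁻ f) := by
  have : Continuous (𝓕 f) := VectorFourier.fourierIntegral_continuous Real.continuous_fourierChar
    (by simpa using continuous_inner) hf
  have e : 𝓕⁻ f = fun ξ => 𝓕 f (-ξ) := by ext ξ; exact Real.fourierInv_eq_fourier_neg f ξ
  rw [e]
  exact this.comp continuous_neg

theorem continuous_fourier {f : E → ℂ} (hf : Integrable f) : Continuous (𝓕 f) :=
  VectorFourier.fourierIntegral_continuous Real.continuous_fourierChar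
    (by simpa using continuous_inner) hf

/-- A compactly supported smooth real function as a complex Schwartz function. -/
def ofRealSchwartz {g : E → ℝ} (h1 : ContDiff ℝ (⊤ : ℕ∞) g) (h2 : HasCompactSupport g) :
    𝓢(E, ℂ) :=
  (h2.comp_left (g := fun r : ℝ => (r : ℂ)) Complex.ofReal_zero).toSchwartzMap
    (Complex.ofRealCLM.contDiff.comp h1)

theorem ofRealSchwartz_apply {g : E → ℝ} (h1 : ContDiff ℝ (⊤ : ℕ∞) g)
    (h2 : HasCompactSupport g) (x : E) : ofRealSchwartz h1 h2 x = (g x : ℂ) := rfl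

theorem ae_eq_of_integral_schwartz_mul_eq {f g : E → ℂ} (hf : LocallyIntegrable f)
    (hg : LocallyIntegrable g)
    (h : ∀ θ : 𝓢(E, ℂ), ∫ x, f x * θ x = ∫ x, g x * θ x) : f =ᵐ[volume] g := by
  refine ae_eq_of_integral_contDiff_smul_eq hf hg fun θ h1 h2 => ?_
  have := h (ofRealSchwartz h1 h2)
  simp only [ofRealSchwartz_apply] at this
  simpa [mul_comm] using this

/-- Uniqueness for the Fourier transform of integrable functions. -/
theorem ae_eq_zero_of_fourier_eq_zero {g : E → ℂ} (hg : Integrable g)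
    (h : ∀ x, 𝓕 g x = 0) : g =ᵐ[volume] 0 := by
  refine ae_eq_of_integral_schwartz_mul_eq hg.locallyIntegrable
    (integrable_zero _ _ _).locallyIntegrable fun θ => ?_
  have h1 := integral_fourier_mul hg (𝓕⁻ θ).integrable
  rw [← SchwartzMap.fourier_coe, FourierTransform.fourier_fourierInv_eq] at h1
  rw [← h1]
  simp [h]

/-- The inverse Fourier transform maps `L¹ ∩ L²` to `L²`. -/
theorem memLp_fourierInv {g : E → ℂ} (hg : Integrable g) (hg2 : MemLp g 2 volume) :
    MemLp (𝓕⁻ g) 2 volume := by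
  obtain ⟨L, hL⟩ : ∃ L : Lp ℂ 2 (volume : Measure E), L =ᵐ[volume] g :=
    ⟨hg2.toLp g, hg2.coeFn_toLp⟩
  obtain ⟨G, hG⟩ : ∃ G : Lp ℂ 2 (volume : Measure E), 𝓕⁻ L = G := ⟨_, rfl⟩
  have hGm : MemLp G 2 volume := Lp.memLp G
  have key : (G : E → ℂ) =ᵐ[volume] 𝓕⁻ g := by
    -- The `L²` transform, defined by extension, and the integral transform agree as tempered
    -- distributions, hence almost everywhere.
    refine ae_eq_of_integral_schwartz_mul_eq (hGm.locallyIntegrable (by norm_num))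
      (continuous_fourierInv hg).locallyIntegrable fun θ => ?_
    rw [integral_fourierInv_mul hg θ.integrable]
    have h1 : 𝓕⁻ (L : 𝓢'(E, ℂ)) θ = (G : 𝓢'(E, ℂ)) θ := by
      rw [Lp.fourierInv_toTemperedDistribution_eq, hG]
    rw [TemperedDistribution.fourierInv_apply, Lp.toTemperedDistribution_apply,
      Lp.toTemperedDistribution_apply] at h1
    simp only [smul_eq_mul] at h1
    simp_rw [mul_comm _ (θ _)]
    rw [← h1, ← SchwartzMap.fourierInv_coe]
    refine integral_congr_ae ?_
    filter_upwards [hL] with x hx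
    rw [hx, mul_comm]
  exact (memLp_congr_ae key).1 hGm

end FourierFormulas

/-! ### The `L²` pairing and Parseval's formula in the limit. -/

section Pairing

variable {E : Type*} [MeasurableSpace E] {μ : Measure E}

theorem integrable_mul_of_memLp_two {a b : E → ℂ} (ha : MemLp a 2 μ) (hb : MemLp b 2 μ) :
    Integrable (fun x => a x * b x) μ := ha.integrable_mul hb

/-- Continuity of the `L²` pairing. -/
theorem tendsto_integral_mul_of_memLp_two {a : ℕ → E → ℂ} {a₀ b : E → ℂ}
    (ha : ∀ k, MemLp (a k) 2 μ) (ha₀ : MemLp a₀ 2 μ) (hb : MemLp b 2 μ)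
    (h : ∀ k, ∫⁻ x, ‖a k x - a₀ x‖ₑ ^ 2 ∂μ ≤ 2⁻¹ ^ k) :
    Tendsto (fun k => ∫ x, a k x * b x ∂μ) atTop (𝓝 (∫ x, a₀ x * b x ∂μ)) := by
  rw [tendsto_iff_edist_tendsto_0]
  have hr : ∀ f : E → ℂ, recipNorm (1 / 2) (fun x => ‖f x‖ₑ) μ = (∫⁻ x, ‖f x‖ₑ ^ 2 ∂μ) ^ (1 / 2 : ℝ) := by
    intro f
    unfold recipNorm
    norm_num
  have hbfin : recipNorm (1 / 2) (fun x => ‖b x‖ₑ) μ ≠ ⊤ := by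
    rw [hr, ← eLpNorm_two_sq]
    exact ENNReal.rpow_ne_top_of_nonneg (by norm_num) (ENNReal.pow_lt_top hb.2).ne
  have hbound : ∀ k, edist (∫ x, a k x * b x ∂μ) (∫ x, a₀ x * b x ∂μ) ≤
      ((2⁻¹ : ℝ≥0∞) ^ k) ^ (1 / 2 : ℝ) * recipNorm (1 / 2) (fun x => ‖b x‖ₑ) μ := by
    intro k
    rw [edist_eq_enorm_sub, ← integral_sub (integrable_mul_of_memLp_two (ha k) hb)
      (integrable_mul_of_memLp_two ha₀ hb)]
    have hh := recipNorm_mul_le (μ := μ) (a := 1 / 2) (b := 1 / 2) (by norm_num) (by norm_num)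
      (f := fun x => ‖a k x - a₀ x‖ₑ) (g := fun x => ‖b x‖ₑ)
      ((ha k).1.sub ha₀.1).enorm hb.1.enorm
    norm_num at hh
    rw [recipNorm_one] at hh
    calc ‖∫ x, (a k x * b x - a₀ x * b x) ∂μ‖ₑ ≤ ∫⁻ x, ‖a k x * b x - a₀ x * b x‖ₑ ∂μ :=
          enorm_integral_le_lintegral_enorm _
      _ = ∫⁻ x, ‖a k x - a₀ x‖ₑ * ‖b x‖ₑ ∂μ := by simp_rw [← sub_mul, enorm_mul]
      _ ≤ _ := hh
      _ ≤ _ := by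
        norm_num
        gcongr
        have := hr (fun x => a k x - a₀ x)
        norm_num at this
        rw [this]
        exact ENNReal.rpow_le_rpow (h k) (by norm_num)
  refine tendsto_of_tendsto_of_tendsto_of_le_of_le tendsto_const_nhds ?_ (fun _ => zero_le) hbound
  have h1 : Tendsto (fun k : ℕ => ((2⁻¹ : ℝ≥0∞) ^ k) ^ (1 / 2 : ℝ)) atTop (𝓝 0) := by
    have h2 := ((ENNReal.continuous_rpow_const (y := (1 / 2 : ℝ))).tendsto 0).comp
      (ENNReal.tendsto_pow_atTop_nhds_zero_of_lt_one (r := 2⁻¹) (by simp))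
    rwa [ENNReal.zero_rpow_of_pos (by norm_num)] at h2
  have h3 := ENNReal.Tendsto.mul_const h1 (Or.inr hbfin)
  rwa [zero_mul] at h3

end Pairing

theorem memLp_two_of_weighted {U : Plane → ℂ} (hU : Measurable U)
    (h : ∫⁻ ξ, eweight ξ * ‖U ξ‖ₑ ^ 2 < ⊤) : MemLp U 2 volume := by
  refine ⟨hU.aestronglyMeasurable, ?_⟩
  have h1 : eLpNorm U 2 volume ^ 2 < ⊤ := by
    rw [eLpNorm_two_sq]
    refine lt_of_le_of_lt (lintegral_mono fun ξ => ?_) h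
    exact le_mul_of_one_le_left zero_le (one_le_eweight ξ)
  by_contra hcon
  rw [not_lt_top_iff.1 hcon] at h1
  simp at h1

theorem memLp_lift {φ : ℝ × ℝ → ℝ} (h : MemLp φ 2 volume) : MemLp (lift φ) 2 volume :=
  (h.comp_measurePreserving measurePreserving_ofLp).ofReal

/-- Parseval's formula for the limit of a sequence of Schwartz functions. -/
theorem integral_mul_fourierInv_eq {f : ℕ → 𝓢(Plane, ℂ)} {Φ U : Plane → ℂ}
    (hΦ : MemLp Φ 2 volume) (hU : MemLp U 2 volume)
    (h2 : ∀ k, ∫⁻ x, ‖f k x - Φ x‖ₑ ^ 2 ≤ 2⁻¹ ^ k)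
    (hw : ∀ k, ∫⁻ ξ, eweight ξ * ‖𝓕⁻ (f k) ξ - U ξ‖ₑ ^ 2 ≤ 2⁻¹ ^ k) {b : Plane → ℂ}
    (hb : Integrable b) (hb2 : MemLp b 2 volume) :
    ∫ x, Φ x * 𝓕⁻ b x = ∫ ξ, U ξ * b ξ := by
  have t1 := tendsto_integral_mul_of_memLp_two (fun k => (f k).memLp 2 volume) hΦ
    (memLp_fourierInv hb hb2) h2
  have t2 := tendsto_integral_mul_of_memLp_two (fun k => (𝓕⁻ (f k)).memLp 2 volume) hU hb2
    (fun k => le_trans (lintegral_mono fun ξ =>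
      le_mul_of_one_le_left zero_le (one_le_eweight ξ)) (hw k))
  refine tendsto_nhds_unique t1 (t2.congr fun k => ?_)
  have := integral_fourierInv_mul (f k).integrable hb
  rw [← this, SchwartzMap.fourierInv_coe]

theorem integrable_exp_mul {h : Plane → ℂ} (hh : Integrable h) (v : Plane) :
    Integrable fun ξ : Plane => Complex.exp (↑(2 * Real.pi * inner ℝ ξ v) * Complex.I) * h ξ := by
  refine hh.norm.mono' ?_ (Eventually.of_forall fun ξ => ?_)
  · exact (Continuous.aestronglyMeasurable (by fun_prop)).mul hh.1
  · rw [norm_mul, Complex.norm_exp_ofReal_mul_I, one_mul]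

theorem fourierInv_linear_combination {h₀ h₁ h₂ : Plane → ℂ} (i₀ : Integrable h₀)
    (i₁ : Integrable h₁) (i₂ : Integrable h₂) (a b c : ℂ) (v : Plane) :
    𝓕⁻ (fun ξ => a * h₀ ξ + b * h₁ ξ + c * h₂ ξ) v =
      a * 𝓕⁻ h₀ v + b * 𝓕⁻ h₁ v + c * 𝓕⁻ h₂ v := by
  simp only [Real.fourierInv_eq', smul_eq_mul]
  rw [← integral_const_mul, ← integral_const_mul, ← integral_const_mul, ← integral_add,
    ← integral_add]
  · congr 1; ext ξ; ring
  · exact ((integrable_exp_mul i₀ v).const_mul a).add ((integrable_exp_mul i₁ v).const_mul b)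
  · exact (integrable_exp_mul i₂ v).const_mul c
  · exact (integrable_exp_mul i₀ v).const_mul a
  · exact (integrable_exp_mul i₁ v).const_mul b

theorem fourier_lineDeriv_snd (f : 𝓢(Plane, ℂ)) (ξ : Plane) :
    𝓕 (∂_{(WithLp.toLp 2 ((0 : ℝ), (1 : ℝ)) : Plane)} f) ξ =
      (2 * Real.pi * Complex.I) * (ξ.snd * 𝓕 f ξ) := by
  have hg : (fun x : Plane => inner ℝ x (WithLp.toLp 2 ((0 : ℝ), (1 : ℝ)) : Plane)).HasTemperateGrowth := by
    fun_prop
  have hs : (fun x : Plane => x.snd).HasTemperateGrowth := by simpa using hg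
  rw [SchwartzMap.fourier_lineDerivOp_eq]
  simp [SchwartzMap.smulLeftCLM_apply_apply hs]

theorem IsTest.partialY {ψ : ℝ × ℝ → ℝ} (h : IsTest ψ) : IsTest (partialY ψ) := by
  set d := ∂_{(WithLp.toLp 2 ((0 : ℝ), (1 : ℝ)) : Plane)} h.toSchwartz with hd
  have e : BOZK.partialY ψ = fun z => (d (WithLp.toLp 2 z)).re := by
    ext z
    rw [hd, h.lineDeriv_toSchwartz]
    simp
  have hto : ContDiff ℝ (⊤ : ℕ∞) (WithLp.toLp 2 : ℝ × ℝ → Plane) :=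
    (WithLp.prodContinuousLinearEquiv 2 ℝ ℝ ℝ).symm.contDiff
  rw [e]
  refine ⟨Complex.reCLM.contDiff.comp (d.smooth'.comp hto), ?_⟩
  have hc : HasCompactSupport d :=
    h.hasCompactSupport_lift.of_isClosed_subset (isClosed_tsupport _)
      (SchwartzMap.tsupport_lineDerivOp_subset (f := h.toSchwartz) _)
  exact (hc.comp_homeomorph
    (WithLp.prodContinuousLinearEquiv 2 ℝ ℝ ℝ).symm.toHomeomorph).comp_left Complex.zero_re

theorem IsTest.partialY_partialY_eq {ψ : ℝ × ℝ → ℝ} (h : IsTest ψ) (v : Plane) :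
    (BOZK.partialY (BOZK.partialY ψ) v.ofLp : ℂ) =
      𝓕⁻ (fun ξ : Plane => ((-(2 * Real.pi * ξ.snd) ^ 2 : ℝ) : ℂ) * 𝓕 h.toSchwartz ξ) v := by
  set d := ∂_{(WithLp.toLp 2 ((0 : ℝ), (1 : ℝ)) : Plane)} h.toSchwartz with hd
  have e1 : h.partialY.toSchwartz = d := by
    ext x
    rw [IsTest.toSchwartz_apply, hd, h.lineDeriv_toSchwartz]
  have e2 := h.partialY.lineDeriv_toSchwartz v
  rw [e1] at e2
  rw [← e2]
  set d2 := ∂_{(WithLp.toLp 2 ((0 : ℝ), (1 : ℝ)) : Plane)} d with hd2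
  have e3 : d2 v = 𝓕⁻ (𝓕 d2) v := by rw [FourierTransform.fourierInv_fourier_eq]
  rw [e3, SchwartzMap.fourierInv_coe]
  refine congrArg (fun h : Plane → ℂ => 𝓕⁻ h v) (funext fun ξ => ?_)
  rw [hd2, fourier_lineDeriv_snd, hd, fourier_lineDeriv_snd]
  push_cast
  linear_combination (4 * (Real.pi : ℂ) ^ 2 * ξ.snd ^ 2 * 𝓕 h.toSchwartz ξ) * Complex.I_sq

/-! ### The symbol of the linear part and its ellipticity. -/

/-- The symbol of the operator `-c + α ℋ ∂ₓ + ε ∂_y²`. -/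
def symbol (α ε c : ℝ) (ξ : Plane) : ℝ :=
  -c + α * (2 * cosConst * |ξ.fst|) + ε * (-(2 * Real.pi * ξ.snd) ^ 2)

theorem norm_symbol_le (α ε c : ℝ) :
    ∃ C : ℝ, ∀ ξ, ‖(symbol α ε c ξ : ℂ)‖ ≤ C * (1 + ‖ξ‖ ^ 2) := by
  have hc0 := cosConst_pos
  refine ⟨|c| + |α| * (2 * cosConst) + |ε| * (2 * Real.pi) ^ 2, fun ξ => ?_⟩
  have h1 : |ξ.fst| ≤ 1 + ‖ξ‖ ^ 2 := by
    nlinarith [abs_fst_le_norm ξ, sq_nonneg (‖ξ‖ - 1), norm_nonneg ξ]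
  have h2 : ξ.snd ^ 2 ≤ 1 + ‖ξ‖ ^ 2 := by
    have : |ξ.snd| ^ 2 ≤ ‖ξ‖ ^ 2 := by gcongr; exact abs_snd_le_norm ξ
    rw [sq_abs] at this
    linarith
  rw [Complex.norm_real, Real.norm_eq_abs, symbol]
  calc |-c + α * (2 * cosConst * |ξ.fst|) + ε * (-(2 * Real.pi * ξ.snd) ^ 2)|
      ≤ |-c| + |α * (2 * cosConst * |ξ.fst|)| + |ε * (-(2 * Real.pi * ξ.snd) ^ 2)| :=
        (abs_add_le _ _).trans (add_le_add_left (abs_add_le _ _) _)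
    _ = |c| + |α| * (2 * cosConst) * |ξ.fst| + |ε| * (2 * Real.pi) ^ 2 * ξ.snd ^ 2 := by
        rw [abs_neg, abs_mul, abs_mul, abs_mul ε, abs_neg, abs_abs, abs_of_pos
          (by positivity : 0 < 2 * cosConst), abs_of_nonneg (sq_nonneg (2 * Real.pi * ξ.snd))]
        ring
    _ ≤ |c| * (1 + ‖ξ‖ ^ 2) + |α| * (2 * cosConst) * (1 + ‖ξ‖ ^ 2) +
          |ε| * (2 * Real.pi) ^ 2 * (1 + ‖ξ‖ ^ 2) := by
        gcongr
        exact le_mul_of_one_le_right (abs_nonneg c) (by nlinarith [sq_nonneg ‖ξ‖])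
    _ = _ := by ring

theorem continuous_symbol (α ε c : ℝ) : Continuous fun ξ => (symbol α ε c ξ : ℂ) := by
  unfold symbol; fun_prop

/-- The hypotheses give `-c`, `α` and `-ε` a common sign, so no cancellation occurs and the modulus
of the symbol is the sum of the moduli of its terms. -/
theorem weight_le_abs_symbol {α ε c : ℝ} (hε : ε = 1 ∨ ε = -1) (hαε : α * ε < 0)
    (hcα : c * α < 0) : ∃ m : ℝ, 0 < m ∧ ∀ ξ, m * weight ξ ≤ |symbol α ε c ξ| := by
  have hc0 := cosConst_pos
  have hα : α ≠ 0 := by rintro rfl; simp at hαε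
  have hc : c ≠ 0 := by rintro rfl; simp at hcα
  set b := |α| * (2 * cosConst)
  set d := (2 * Real.pi) ^ 2
  have hb : 0 < b := by have := abs_pos.2 hα; positivity
  have hd : 0 < d := by positivity
  refine ⟨min |c| (min b d), lt_min (abs_pos.2 hc) (lt_min hb hd), fun ξ => ?_⟩
  have key : |symbol α ε c ξ| = |c| + b * |ξ.fst| + d * ξ.snd ^ 2 := by
    have hnn : 0 ≤ |c| + b * |ξ.fst| + d * ξ.snd ^ 2 := by positivity
    rcases hε with rfl | rfl
    · have hα' : α < 0 := by linarith
      have hc' : 0 < c := by nlinarith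
      have : symbol α 1 c ξ = -(|c| + b * |ξ.fst| + d * ξ.snd ^ 2) := by
        simp only [symbol, b, d, abs_of_neg hα', abs_of_pos hc']; ring
      rw [this, abs_neg, abs_of_nonneg hnn]
    · have hα' : 0 < α := by linarith
      have hc' : c < 0 := by nlinarith
      have : symbol α (-1) c ξ = |c| + b * |ξ.fst| + d * ξ.snd ^ 2 := by
        simp only [symbol, b, d, abs_of_pos hα', abs_of_neg hc']; ring
      rw [this, abs_of_nonneg hnn]
  rw [key, weight]
  have m1 : min |c| (min b d) ≤ |c| := min_le_left _ _
  have m2 : min |c| (min b d) ≤ b := (min_le_right _ _).trans (min_le_left _ _)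
  have m3 : min |c| (min b d) ≤ d := (min_le_right _ _).trans (min_le_right _ _)
  have := mul_le_mul_of_nonneg_right m2 (abs_nonneg ξ.fst)
  have := mul_le_mul_of_nonneg_right m3 (sq_nonneg ξ.snd)
  linarith

/-- Since `|ξ₁|` is not smooth, the product of the symbol with a Schwartz function is in general
only in `L¹ ∩ L²`; this is why Parseval's formula is stated for that class. -/
theorem IsTest.operator_eq_fourierInv {ψ : ℝ × ℝ → ℝ} (h : IsTest ψ) (α ε c : ℝ) (v : Plane) :
    ((-c * ψ v.ofLp + α * hilbertX (partialX ψ) v.ofLp +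
      ε * BOZK.partialY (BOZK.partialY ψ) v.ofLp : ℝ) : ℂ) =
      𝓕⁻ (fun ξ => (symbol α ε c ξ : ℂ) * 𝓕 h.toSchwartz ξ) v := by
  set F := 𝓕 h.toSchwartz with hF
  have hc0 := cosConst_pos
  have i0 : Integrable (fun ξ => F ξ) := F.integrable
  have i1 := (symbol_mul_schwartz (m := fun ξ => ((2 * cosConst * |ξ.fst| : ℝ) : ℂ)) (by fun_prop)
    (C := 2 * cosConst) (fun ξ => by
      rw [Complex.norm_real, Real.norm_of_nonneg (by positivity)]
      gcongr
      nlinarith [abs_fst_le_norm ξ, sq_nonneg (‖ξ‖ - 1), norm_nonneg ξ]) F).1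
  have i2 := (symbol_mul_schwartz (m := fun ξ => ((-(2 * Real.pi * ξ.snd) ^ 2 : ℝ) : ℂ))
    (by fun_prop) (C := (2 * Real.pi) ^ 2) (fun ξ => by
      rw [Complex.norm_real, norm_neg, Real.norm_of_nonneg (by positivity), mul_pow]
      gcongr
      have : |ξ.snd| ^ 2 ≤ ‖ξ‖ ^ 2 := by gcongr; exact abs_snd_le_norm ξ
      rw [sq_abs] at this
      linarith) F).1
  have e0 : (ψ v.ofLp : ℂ) = 𝓕⁻ (fun ξ => F ξ) v := by
    have : (ψ v.ofLp : ℂ) = 𝓕⁻ F v := by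
      rw [hF, FourierTransform.fourierInv_fourier_eq, h.toSchwartz_apply]
    rw [this, SchwartzMap.fourierInv_coe]
  have key := fourierInv_linear_combination i0 i1 i2 (-c) α ε v
  push_cast
  rw [e0, h.hilbertX_eq_fourierInv, h.partialY_partialY_eq, ← hF, ← key]
  refine congrArg (fun h : Plane → ℂ => 𝓕⁻ h v) (funext fun ξ => ?_)
  simp only [symbol]
  push_cast
  ring

/-! ### Fourier transforms of test functions determine functions. -/

theorem IsTest.translate {ψ : ℝ × ℝ → ℝ} (h : IsTest ψ) (a : ℝ × ℝ) :
    IsTest fun z => ψ (z - a) :=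
  ⟨h.1.comp (contDiff_id.sub contDiff_const),
    h.2.comp_homeomorph (Homeomorph.subRight a)⟩

theorem IsTest.fourier_translate {ψ : ℝ × ℝ → ℝ} (h : IsTest ψ) (a ξ : Plane) :
    𝓕 (h.translate a.ofLp).toSchwartz ξ =
      Complex.exp (↑(-2 * Real.pi * inner ℝ ξ a) * Complex.I) * 𝓕 h.toSchwartz ξ := by
  rw [SchwartzMap.fourier_coe, SchwartzMap.fourier_coe, Real.fourier_eq', Real.fourier_eq',
    ← integral_const_mul, ← integral_add_right_eq_self _ a]
  refine integral_congr_ae (Eventually.of_forall fun x => ?_)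
  simp only [smul_eq_mul, IsTest.toSchwartz_apply, WithLp.ofLp_add, add_sub_cancel_right]
  rw [← mul_assoc, ← Complex.exp_add, inner_add_left, real_inner_comm a ξ]
  congr 2
  push_cast
  ring

/-- The Fourier transforms of test functions have no common zero. -/
theorem exists_isTest_seq_fourier_ne_zero : ∃ χ : ℕ → ℝ × ℝ → ℝ, ∃ h : ∀ k, IsTest (χ k),
    ∀ ξ, ∃ k, 𝓕 (h k).toSchwartz ξ ≠ 0 := by
  let φ : ℕ → ContDiffBump (0 : ℝ × ℝ) := fun k =>
    ⟨1 / ((k : ℝ) + 1) / 2, 1 / ((k : ℝ) + 1), by positivity, half_lt_self (by positivity)⟩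
  have hφ : Tendsto (fun k => (φ k).rOut) atTop (𝓝 0) := tendsto_one_div_add_atTop_nhds_zero_nat
  refine ⟨fun k => (φ k).normed volume,
    fun k => ⟨(φ k).contDiff_normed, (φ k).hasCompactSupport_normed⟩, fun ξ => ?_⟩
  by_contra! hcon
  let g : ℝ × ℝ → ℂ := fun z =>
    Complex.exp (↑(2 * Real.pi * inner ℝ (WithLp.toLp 2 z : Plane) ξ) * Complex.I)
  have hto : Continuous (WithLp.toLp 2 : ℝ × ℝ → Plane) :=
    (WithLp.prodContinuousLinearEquiv 2 ℝ ℝ ℝ).symm.continuous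
  have hg : Continuous g := by fun_prop
  -- The Fourier transform of a bump at `ξ` is its convolution with a character at `0`, which tends
  -- to `1` as the bumps shrink, so it cannot vanish for every `k`.
  have ht := ContDiffBump.convolution_tendsto_right_of_continuous (μ := volume) hφ hg 0
  have h0 : ∀ k, ((φ k).normed volume ⋆[ContinuousLinearMap.lsmul ℝ ℝ, volume] g) 0 = 0 := by
    intro k
    rw [← hcon k, SchwartzMap.fourier_coe, Real.fourier_eq', convolution_def, ← integral_plane_eq]
    refine integral_congr_ae (Eventually.of_forall fun x => ?_)
    simp only [ContinuousLinearMap.lsmul_apply, g, zero_sub, WithLp.toLp_neg, WithLp.toLp_ofLp,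
      inner_neg_left, smul_eq_mul, Complex.real_smul]
    rw [mul_comm]
    congr 3
    push_cast
    ring
  simp only [h0] at ht
  have h1 := tendsto_nhds_unique tendsto_const_nhds ht
  exact (Complex.exp_ne_zero _) h1.symm

/-- A function that annihilates the Fourier transforms of all test functions is zero. -/
theorem ae_eq_zero_of_integral_mul_fourier_eq_zero {h : Plane → ℂ}
    (hint : ∀ F : 𝓢(Plane, ℂ), Integrable fun ξ => h ξ * F ξ)
    (hzero : ∀ (ψ : ℝ × ℝ → ℝ) (hψ : IsTest ψ), ∫ ξ, h ξ * 𝓕 hψ.toSchwartz ξ = 0) :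
    h =ᵐ[volume] 0 := by
  obtain ⟨χ, hχ, hne⟩ := exists_isTest_seq_fourier_ne_zero
  -- Testing with all translates of `χ k` inserts every character, so the integrable product has
  -- zero Fourier transform. The family `χ` is countable so that the exceptional null sets can be
  -- united.
  have key : ∀ k, (fun ξ => h ξ * 𝓕 (hχ k).toSchwartz ξ) =ᵐ[volume] 0 := fun k => by
    refine ae_eq_zero_of_fourier_eq_zero (hint _) fun a => ?_
    rw [Real.fourier_eq', ← hzero _ ((hχ k).translate a.ofLp)]
    refine integral_congr_ae (Eventually.of_forall fun ξ => ?_)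
    simp only [(hχ k).fourier_translate a ξ, smul_eq_mul]
    ring
  filter_upwards [ae_all_iff.2 key] with ξ hξ
  obtain ⟨k, hk⟩ := hne ξ
  exact (mul_eq_zero.1 (hξ k)).resolve_right hk

theorem norm_fourierInv_le {G : Plane → ℂ} (ξ : Plane) : ‖𝓕⁻ G ξ‖ ≤ ∫ x, ‖G x‖ := by
  rw [Real.fourierInv_eq']
  refine (norm_integral_le_integral_norm _).trans (le_of_eq ?_)
  refine integral_congr_ae (Eventually.of_forall fun x => ?_)
  simp only [norm_smul, Complex.norm_exp_ofReal_mul_I, one_mul]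

/-! ### The convolution inequality for a solitary wave. -/

/-- The Fourier side of the equation of solitary waves, as a convolution inequality. -/
theorem IsSolitaryWave.exists_convolution_ineq {p : ℕ} (hp1 : 1 ≤ p) (hp4 : p < 4) {α ε c : ℝ}
    (hε : ε = 1 ∨ ε = -1) (hαε : α * ε < 0) (hcα : c * α < 0)
    {φ : ℝ × ℝ → ℝ} (hφ : IsSolitaryWave p α ε c φ) :
    ∃ (U : Plane → ℂ) (K : ℝ≥0∞), Measurable U ∧ ∫⁻ ξ, eweight ξ * ‖U ξ‖ₑ ^ 2 < ⊤ ∧ K ≠ ⊤ ∧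
      (∀ᵐ ξ, eweight ξ * ‖U ξ‖ₑ ≤ K * convPow (fun η => ‖U η‖ₑ) volume p ξ) ∧
      ∀ b : Plane → ℂ, Integrable b → MemLp b 2 volume →
        ∫ x, lift φ x * 𝓕⁻ b x = ∫ ξ, U ξ * b ξ := by
  obtain ⟨f, U, hU, hfin, h2, h4, hw⟩ := hφ.memZ.exists_approx
  have hΦ2 : MemLp (lift φ) 2 volume := memLp_lift hφ.memZ.1
  have hU2 := memLp_two_of_weighted hU hfin
  obtain ⟨hG, hGle⟩ := enorm_fourierInv_pow_le hU hΦ2.1 hfin h2 h4 hw hp1 hp4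
  set G : Plane → ℂ := fun x => lift φ x ^ (p + 1) with hGdef
  have pars : ∀ b : Plane → ℂ, Integrable b → MemLp b 2 volume →
      ∫ x, lift φ x * 𝓕⁻ b x = ∫ ξ, U ξ * b ξ := fun b =>
    integral_mul_fourierInv_eq hΦ2 hU2 h2 hw
  obtain ⟨C, hC⟩ := norm_symbol_le α ε c
  have hsym := fun F : 𝓢(Plane, ℂ) => symbol_mul_schwartz (continuous_symbol α ε c) hC F
  have hp0 : ((p : ℂ) + 1) ≠ 0 := by exact_mod_cast Nat.succ_ne_zero p
  have hGF : ∀ F : 𝓢(Plane, ℂ), Integrable fun ξ => 𝓕⁻ G ξ * F ξ := fun F =>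
    F.integrable.bdd_mul (continuous_fourierInv hG).aestronglyMeasurable
      (Eventually.of_forall norm_fourierInv_le)
  have hUF : ∀ F : 𝓢(Plane, ℂ), Integrable fun ξ => U ξ * ((symbol α ε c ξ : ℂ) * F ξ) := fun F =>
    integrable_mul_of_memLp_two hU2 (hsym F).2
  -- The weak equation transported to the Fourier side: Parseval handles the linear part, the
  -- multiplication formula the nonlinear part, whose density `G` is only known to be integrable.
  have hzero : (fun ξ => U ξ * (symbol α ε c ξ : ℂ) + ((p : ℂ) + 1)⁻¹ * 𝓕⁻ G ξ)
      =ᵐ[volume] 0 := by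
    refine ae_eq_zero_of_integral_mul_fourier_eq_zero (fun F => ?_) fun ψ hψ => ?_
    · refine ((hUF F).add ((hGF F).const_mul ((p : ℂ) + 1)⁻¹)).congr
        (Eventually.of_forall fun ξ => ?_)
      simp only [Pi.add_apply]
      ring
    · set F := 𝓕 hψ.toSchwartz with hF
      have hf : 𝓕⁻ (F : Plane → ℂ) = hψ.toSchwartz := by
        rw [← SchwartzMap.fourierInv_coe, hF, FourierTransform.fourierInv_fourier_eq]
      have e1 : ∫ ξ, 𝓕⁻ G ξ * F ξ = ∫ x, G x * hψ.toSchwartz x := by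
        rw [integral_fourierInv_mul hG F.integrable, hf]
      have e2 := pars _ (hsym F).1 (hsym F).2
      have iG : Integrable fun x => G x * hψ.toSchwartz x := by
        rw [← hf]
        exact hG.mul_bdd (continuous_fourierInv F.integrable).aestronglyMeasurable
          (Eventually.of_forall norm_fourierInv_le)
      have iΦ := integrable_mul_of_memLp_two hΦ2 (memLp_fourierInv (hsym F).1 (hsym F).2)
      have weak := hφ.weak_eq ψ hψ
      rw [← integral_plane_eq, ← Complex.ofReal_inj, ← integral_complex_ofReal] at weak
      calc ∫ ξ, (U ξ * (symbol α ε c ξ : ℂ) + ((p : ℂ) + 1)⁻¹ * 𝓕⁻ G ξ) * F ξ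
          = ∫ ξ, (U ξ * ((symbol α ε c ξ : ℂ) * F ξ) + ((p : ℂ) + 1)⁻¹ * (𝓕⁻ G ξ * F ξ)) := by
            refine integral_congr_ae (Eventually.of_forall fun ξ => ?_)
            ring_nf
        _ = ∫ x, (lift φ x * 𝓕⁻ (fun ξ => (symbol α ε c ξ : ℂ) * F ξ) x +
              ((p : ℂ) + 1)⁻¹ * (G x * hψ.toSchwartz x)) := by
            rw [integral_add (hUF F) ((hGF F).const_mul _), integral_add iΦ (iG.const_mul _),
              integral_const_mul, integral_const_mul, e1, e2]
        _ = 0 := by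
            rw [← Complex.ofReal_zero, ← weak]
            refine integral_congr_ae (Eventually.of_forall fun x => ?_)
            simp only [hGdef, hψ.toSchwartz_apply, lift]
            rw [← hψ.operator_eq_fourierInv α ε c x]
            push_cast
            field_simp
  obtain ⟨m, hm, hmw⟩ := weight_le_abs_symbol hε hαε hcα
  refine ⟨U, ENNReal.ofReal m⁻¹, hU, hfin, ENNReal.ofReal_ne_top, ?_, pars⟩
  filter_upwards [hzero, hGle] with ξ h1 h3
  refine le_trans ?_ (mul_le_mul_right h3 _)
  rw [← ofReal_norm, ← ofReal_norm, eweight, ← ENNReal.ofReal_mul (weight_pos ξ).le,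
    ← ENNReal.ofReal_mul (by positivity)]
  refine ENNReal.ofReal_le_ofReal ?_
  have h5 : |symbol α ε c ξ| * ‖U ξ‖ ≤ ‖𝓕⁻ G ξ‖ := by
    have h6 : U ξ * (symbol α ε c ξ : ℂ) = -(((p : ℂ) + 1)⁻¹ * 𝓕⁻ G ξ) :=
      eq_neg_of_add_eq_zero_left h1
    have h7 := congrArg norm h6
    rw [norm_neg, norm_mul, norm_mul, Complex.norm_real, Real.norm_eq_abs, norm_inv] at h7
    rw [mul_comm, h7]
    refine mul_le_of_le_one_left (norm_nonneg _) (inv_le_one_of_one_le₀ ?_)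
    have : ‖(p : ℂ) + 1‖ = (p : ℝ) + 1 := by
      rw [← Nat.cast_succ, Complex.norm_natCast]; push_cast; ring
    rw [this]
    have : (0 : ℝ) ≤ p := Nat.cast_nonneg p
    linarith
  have h8 := mul_le_mul_of_nonneg_right (hmw ξ) (norm_nonneg (U ξ))
  rw [inv_mul_eq_div, le_div_iff₀ hm]
  linarith

/-! ### Holomorphic extension from exponential decay. -/

/-- The Fourier-Laplace transform of a function on the plane. -/
def fourierLaplace (U : Plane → ℂ) (z : ℂ × ℂ) : ℂ :=
  ∫ ξ : Plane, Complex.exp (-(2 * Real.pi * Complex.I) * (z.1 * ξ.fst + z.2 * ξ.snd)) * U ξ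

theorem fourierLaplace_ofReal (U : Plane → ℂ) (v : Plane) :
    fourierLaplace U ((v.fst : ℂ), (v.snd : ℂ)) = 𝓕 U v := by
  rw [fourierLaplace, Real.fourier_eq']
  refine integral_congr_ae (Eventually.of_forall fun ξ => ?_)
  have e : inner ℝ ξ v = v.fst * ξ.fst + v.snd * ξ.snd := by
    simp [WithLp.prod_inner_apply]
  simp only [smul_eq_mul, e]
  congr 2
  push_cast
  ring

theorem isOpen_strip (σ : ℝ) : IsOpen (strip σ) := by
  have h1 : Continuous fun z : ℂ × ℂ => |z.1.im| :=
    (Complex.continuous_im.comp continuous_fst).abs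
  have h2 : Continuous fun z : ℂ × ℂ => |z.2.im| :=
    (Complex.continuous_im.comp continuous_snd).abs
  exact (isOpen_lt h1 continuous_const).inter (isOpen_lt h2 continuous_const)

theorem norm_exp_le_of_mem_strip {σ : ℝ} {z : ℂ × ℂ} (hz : z ∈ strip σ) (x y : ℝ) :
    ‖Complex.exp (-(2 * Real.pi * Complex.I) * (z.1 * x + z.2 * y))‖ ≤
      Real.exp (2 * Real.pi * σ * (|x| + |y|)) := by
  rw [Complex.norm_exp]
  refine Real.exp_le_exp.2 ?_
  have e : (-(2 * Real.pi * Complex.I) * (z.1 * x + z.2 * y)).re =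
      2 * Real.pi * (z.1.im * x + z.2.im * y) := by
    simp
  rw [e, mul_assoc (2 * Real.pi)]
  refine mul_le_mul_of_nonneg_left ?_ (by positivity)
  have h1 : z.1.im * x ≤ σ * |x| := (le_abs_self _).trans (by
    rw [abs_mul]; exact mul_le_mul_of_nonneg_right hz.1.le (abs_nonneg _))
  have h2 : z.2.im * y ≤ σ * |y| := (le_abs_self _).trans (by
    rw [abs_mul]; exact mul_le_mul_of_nonneg_right hz.2.le (abs_nonneg _))
  linarith

/-- Differentiation under the integral. On the strip of half-width `s / (4π)` the exponential costs
only half the available rate `s`; the other half absorbs the factor `|ξ₁| + |ξ₂|` from the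
derivative. -/
theorem differentiableOn_fourierLaplace {U : Plane → ℂ} (hU : Measurable U) {s : ℝ} (hs : 0 < s)
    (h : Integrable fun ξ : Plane => Real.exp (s * (|ξ.fst| + |ξ.snd|)) * ‖U ξ‖) :
    DifferentiableOn ℂ (fourierLaplace U) (strip (s / (4 * Real.pi))) := by
  intro z₀ hz₀
  have hpi := Real.pi_pos
  have hσ : 2 * Real.pi * (s / (4 * Real.pi)) = s / 2 := by field_simp; norm_num
  let L : Plane → ℂ × ℂ →L[ℂ] ℂ := fun ξ =>
    -(2 * Real.pi * Complex.I) • ((ξ.fst : ℂ) • ContinuousLinearMap.fst ℂ ℂ ℂ +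
      (ξ.snd : ℂ) • ContinuousLinearMap.snd ℂ ℂ ℂ)
  let F' : ℂ × ℂ → Plane → ℂ × ℂ →L[ℂ] ℂ := fun z ξ =>
    (Complex.exp (-(2 * Real.pi * Complex.I) * (z.1 * ξ.fst + z.2 * ξ.snd)) * U ξ) • L ξ
  have hL : ∀ ξ, ‖L ξ‖ ≤ 2 * Real.pi * (|ξ.fst| + |ξ.snd|) := by
    intro ξ
    simp only [L, norm_smul, norm_neg, norm_mul, Complex.norm_I, mul_one, Complex.norm_real,
      Complex.norm_ofNat, Real.norm_of_nonneg hpi.le]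
    gcongr
    refine (norm_add_le _ _).trans ?_
    rw [norm_smul, norm_smul, Complex.norm_real, Complex.norm_real, Real.norm_eq_abs,
      Real.norm_eq_abs]
    exact add_le_add
      (mul_le_of_le_one_right (abs_nonneg _) (ContinuousLinearMap.norm_fst_le ℂ ℂ ℂ))
      (mul_le_of_le_one_right (abs_nonneg _) (ContinuousLinearMap.norm_snd_le ℂ ℂ ℂ))
  have hLc : Continuous L := by fun_prop
  have hexpm : ∀ z : ℂ × ℂ, AEStronglyMeasurable (fun ξ : Plane =>
      Complex.exp (-(2 * Real.pi * Complex.I) * (z.1 * ξ.fst + z.2 * ξ.snd)) * U ξ) := fun z =>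
    (Continuous.aestronglyMeasurable (by fun_prop)).mul hU.aestronglyMeasurable
  have hbd : ∀ z ∈ strip (s / (4 * Real.pi)), ∀ ξ : Plane,
      ‖Complex.exp (-(2 * Real.pi * Complex.I) * (z.1 * ξ.fst + z.2 * ξ.snd)) * U ξ‖ ≤
        Real.exp (s / 2 * (|ξ.fst| + |ξ.snd|)) * ‖U ξ‖ := by
    intro z hz ξ
    have := norm_exp_le_of_mem_strip hz ξ.fst ξ.snd
    rw [hσ] at this
    rw [norm_mul]
    gcongr
  have key : HasFDerivAt (fourierLaplace U) (∫ ξ, F' z₀ ξ) z₀ := by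
    refine hasFDerivAt_integral_of_dominated_of_fderiv_le (F' := F') (𝕜 := ℂ)
      (s := strip (s / (4 * Real.pi)))
      (bound := fun ξ : Plane => 4 * Real.pi / s * (Real.exp (s * (|ξ.fst| + |ξ.snd|)) * ‖U ξ‖))
      ((isOpen_strip _).mem_nhds hz₀) (Eventually.of_forall hexpm) ?_ ?_ ?_ (h.const_mul _) ?_
    · refine h.mono' (hexpm z₀) (Eventually.of_forall fun ξ => (hbd z₀ hz₀ ξ).trans ?_)
      gcongr
      linarith
    · exact (hexpm z₀).smul hLc.aestronglyMeasurable
    · refine Eventually.of_forall fun ξ z hz => ?_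
      simp only [F']
      rw [norm_smul]
      set r := |ξ.fst| + |ξ.snd| with hr
      have hr0 : 0 ≤ r := by positivity
      have h1 : s / 2 * r ≤ Real.exp (s / 2 * r) := by
        linarith [Real.add_one_le_exp (s / 2 * r)]
      have h2 : Real.exp (s * r) = Real.exp (s / 2 * r) * Real.exp (s / 2 * r) := by
        rw [← Real.exp_add]; ring_nf
      calc _ ≤ (Real.exp (s / 2 * r) * ‖U ξ‖) * (2 * Real.pi * r) :=
            mul_le_mul (hbd z hz ξ) (hL ξ) (norm_nonneg _) (by positivity)
        _ = 4 * Real.pi / s * (Real.exp (s / 2 * r) * (s / 2 * r) * ‖U ξ‖) := by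
            field_simp; ring
        _ ≤ _ := by rw [h2]; gcongr
    · refine Eventually.of_forall fun ξ z _ => ?_
      have d1 : HasFDerivAt (fun z : ℂ × ℂ =>
          -(2 * Real.pi * Complex.I) * (z.1 * ξ.fst + z.2 * ξ.snd)) (L ξ) z := by
        have : (fun z : ℂ × ℂ => -(2 * Real.pi * Complex.I) * (z.1 * ξ.fst + z.2 * ξ.snd)) =
            L ξ := by
          ext z
          simp [L]
          ring
        rw [this]
        exact (L ξ).hasFDerivAt
      have d2 := d1.cexp.mul_const (U ξ)
      refine d2.congr_fderiv ?_
      simp only [F', smul_smul, mul_comm]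
  exact key.differentiableAt.differentiableWithinAt

/-- Taking `b = 𝓕 θ` with `θ` Schwartz turns Parseval's formula into equality of `Φ` and `𝓕 U` as
distributions. -/
theorem ae_eq_fourier_of_parseval {Φ U : Plane → ℂ} (hΦ : LocallyIntegrable Φ) (hU : Integrable U)
    (h : ∀ b : Plane → ℂ, Integrable b → MemLp b 2 volume →
      ∫ x, Φ x * 𝓕⁻ b x = ∫ ξ, U ξ * b ξ) : Φ =ᵐ[volume] 𝓕 U := by
  refine ae_eq_of_integral_schwartz_mul_eq hΦ (continuous_fourier hU).locallyIntegrable fun θ => ?_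
  have h1 := h _ (𝓕 θ).integrable ((𝓕 θ).memLp 2 volume)
  rw [← SchwartzMap.fourierInv_coe, FourierTransform.fourierInv_fourier_eq] at h1
  rw [h1, integral_fourier_mul hU θ.integrable, SchwartzMap.fourier_coe]

end

end BOZK

/-! ### Analyticity of solitary waves. -/

theorem theorem4p24 (p : ℕ) (hp1 : 1 ≤ p) (hp4 : p < 4) (α ε c : ℝ)
    (hε : ε = 1 ∨ ε = -1) (hαε : α * ε < 0) (hcα : c * α < 0)
    (φ : ℝ × ℝ → ℝ) (hφ : BOZK.IsSolitaryWave p α ε c φ) :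
    ∃ σ : ℝ, 0 < σ ∧ ∃ f : ℂ × ℂ → ℂ,
      DifferentiableOn ℂ f (BOZK.strip σ) ∧
      (∀ᵐ z : ℝ × ℝ, f ((z.1 : ℂ), (z.2 : ℂ)) = ((φ z : ℝ) : ℂ)) ∧
      (Continuous φ → ∀ x y : ℝ, f ((x : ℂ), (y : ℂ)) = ((φ (x, y) : ℝ) : ℂ)) := by
  obtain ⟨U, K, hU, hfin, hK, hineq, pars⟩ :=
    hφ.exists_convolution_ineq hp1 hp4 hε hαε hcα
  have h1 : ∫⁻ ξ, ‖U ξ‖ₑ < ⊤ :=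
    BOZK.lintegral_lt_top_of_weighted hU.enorm hK hineq hp1 hp4 hfin
  obtain ⟨s, hs, hexp⟩ := BOZK.exists_exp_lintegral_lt_top hU.enorm hK hineq h1
  have hUi : Integrable U := ⟨hU.aestronglyMeasurable, h1⟩
  have hUexp : Integrable fun ξ : BOZK.Plane =>
      Real.exp (s * (|ξ.fst| + |ξ.snd|)) * ‖U ξ‖ := by
    refine ⟨(Continuous.aestronglyMeasurable (by fun_prop)).mul
      hU.aestronglyMeasurable.norm, ?_⟩
    rw [hasFiniteIntegral_iff_enorm]
    refine lt_of_eq_of_lt (lintegral_congr fun ξ => ?_) hexp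
    rw [enorm_mul, enorm_norm, Real.enorm_of_nonneg (Real.exp_pos _).le]
  have hae : BOZK.lift φ =ᵐ[volume] 𝓕 U := BOZK.ae_eq_fourier_of_parseval
    ((BOZK.memLp_lift hφ.memZ.1).locallyIntegrable (by norm_num)) hUi pars
  refine ⟨s / (4 * Real.pi), by have := Real.pi_pos; positivity, BOZK.fourierLaplace U,
    BOZK.differentiableOn_fourierLaplace hU hs hUexp, ?_, fun hφc x y => ?_⟩
  · have hmp : MeasurePreserving (WithLp.toLp 2 : ℝ × ℝ → BOZK.Plane) :=
      WithLp.volume_preserving_toLp ℝ ℝ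
    filter_upwards [hmp.quasiMeasurePreserving.ae hae] with z hz
    exact (BOZK.fourierLaplace_ofReal U (WithLp.toLp 2 z)).trans hz.symm
  · have hc : Continuous (BOZK.lift φ) := Complex.continuous_ofReal.comp
      (hφc.comp (WithLp.prodContinuousLinearEquiv 2 ℝ ℝ ℝ).continuous)
    -- Continuous functions that agree almost everywhere for Lebesgue measure agree everywhere, as
    -- nonempty open sets have positive measure.
    have heq := (Continuous.ae_eq_iff_eq volume hc (BOZK.continuous_fourier hUi)).1 hae
    have := congrFun heq (WithLp.toLp 2 (x, y))
    exact (BOZK.fourierLaplace_ofReal U (WithLp.toLp 2 (x, y))).trans this.symm
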